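/- Let $\mathbb K\in\{\mathbb R,\mathbb C\}$, let $n\ge 2$, and set $\alpha=\frac12$ if $\mathbb K=\mathbb R$ and $\alpha=\frac1{\sqrt\pi}$ if $\mathbb K=\mathbb C$. Equip $\mathbb K^n$ with the Euclidean norm $|\cdot|$ (so $\mathbb C^n=\mathbb R^{2n}$ for volume calculations), and let $B=\{x\in\mathbb K^n : \max_k|x_k|\le\alpha\}$ be the cube (polydisc) of volume $1$, with boundary $\partial B$. For $a\in\mathbb K^n$ with $|a|=1$ let $a^\perp=\{x\in\mathbb K^n:\langle x,a\rangle=0\}$. Let $\mathrm{vol}_d$ be $d$-dimensional volume, i.e. $d$-dimensional Hausdorff measure normalized to agree with Lebesgue measure on $\mathbb R^d$. If $\mathbb K=\mathbb R$, the perimeter of the section by $a^\perp$ is $$P_{n-2}(a)=\mathrm{vol}_{n-2}(\partial B\cap a^\perp).$$ If $\mathbb K=\mathbb C$, it is the integral over all phases $\theta$ of the $2(n-2)$-dimensional volumes of the slices of $\partial B\cap a^\perp$ on which a coordinate of modulus $\alpha$ (the first one, so that nothing is counted twice) has phase $\theta$: $$P_{2(n-2)}(a)=\int_0^{2\pi}\mathrm{vol}_{2(n-2)}\Big(\big\{x\in\partial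 B\cap a^\perp : \exists k,\ x_k=\alpha e^{i\theta}\text{ and } |x_j|<\alpha\text{ for all } j<k\big\}\Big)\,d\theta .$$ Then for every $a\in\mathbb K^n$ with $|a|=1$: $$P_{n-2}(a)\ge 2(n-2)\quad\text{if }\mathbb K=\mathbb R,\qquad P_{2(n-2)}(a)\ge 2\pi(n-2)\quad\text{if }\mathbb K=\mathbb C .$$ -/

import Mathlib

open MeasureTheory

noncomputable section

/-- The cube `{x ∈ 𝕜ⁿ : max_k |x_k| ≤ α}` (for `𝕜 = ℂ`, a polydisc), where `𝕜ⁿ` carries the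
Euclidean norm. -/
def cube (𝕜 : Type*) [RCLike 𝕜] (n : ℕ) (α : ℝ) : Set (EuclideanSpace 𝕜 (Fin n)) :=
  {x | ∀ k, ‖x k‖ ≤ α}

/-- The intersection of the topological boundary of the cube with the hyperplane `a^⊥`. -/
def cubeBoundarySection {𝕜 : Type*} [RCLike 𝕜] {n : ℕ} (α : ℝ) (a : EuclideanSpace 𝕜 (Fin n)) :
    Set (EuclideanSpace 𝕜 (Fin n)) :=
  frontier (cube 𝕜 n α) ∩ {x | inner 𝕜 a x = 0}

/-- The perimeter of the section by `a^⊥` of the real cube of volume one: the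
`(n-2)`-dimensional volume (Hausdorff measure, normalized as Lebesgue measure) of the
intersection of `a^⊥` with the boundary of the cube. -/
def realPerimeter {n : ℕ} (a : EuclideanSpace ℝ (Fin n)) : ENNReal :=
  Measure.euclideanHausdorffMeasure (n - 2) (cubeBoundarySection (1 / 2) a)

/-- The slice with phase `θ` of the section of the boundary of the volume-one polydisc: those
points `x` whose first coordinate of maximal modulus `1 / √π` is equal to `exp (iθ) / √π`.
For `θ ∈ [0, 2π)` these slices partition the whole boundary section. -/
def complexSlice {n : ℕ} (a : EuclideanSpace ℂ (Fin n)) (θ : ℝ) :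
    Set (EuclideanSpace ℂ (Fin n)) :=
  {x ∈ cubeBoundarySection (1 / √Real.pi) a |
    ∃ k, x k = ((1 / √Real.pi : ℝ) : ℂ) * Complex.exp (θ * Complex.I) ∧
      ∀ j < k, ‖x j‖ < 1 / √Real.pi}

/-- The complex perimeter: the `2(n-2)`-dimensional volumes of the slices of the boundary section
with phase `θ`, integrated over all `θ ∈ [0, 2π)`. -/
def complexPerimeter {n : ℕ} (a : EuclideanSpace ℂ (Fin n)) : ENNReal :=
  ∫⁻ θ in Set.Ico 0 (2 * Real.pi),
    Measure.euclideanHausdorffMeasure (2 * (n - 2)) (complexSlice a θ)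

end

open Measure Module

/-! Let `d` be the real dimension of `𝕜`, `A` the volume of the section of the cube by `a^⊥`, and
`V_k` the volume of the part of that section where `x_k` is the first coordinate of maximal modulus.
This part is a union of cones with apex 0 over the pieces of the boundary section with `|x_k| = α`,
so integrating along `x_k` expresses the boundary volume `F_k` of these pieces (in the complex case
integrated over the phase) through `V_k`: `F_k = 2(n-1)√(1-|a_k|²) V_k` over the reals and `F_k =
2π(n-1)(1-|a_k|²) V_k` over the complex numbers. Since `√u ≥ u` on `[0,1]`, both perimeters are at
least `K ∑ (1-|a_k|²)(n-1)V_k` with `K = 2` or `K = 2π`.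

Two facts then suffice. The first is `A ≥ 1` (`one_le_sectionVolume_cube`): the law of `⟨a,x⟩` for
`x` uniform in the cube has its largest density `A` at 0, and it has the same second moment as the
uniform law on the disc of volume one, which is the most concentrated law of density at most one.
The second is `(n-1)V_k ≤ A` (`mul_sectionVolume_cone_le`): the slab `|x_k| ≤ sα` carries at least
the fraction `s^d` of the section, whereas it carries at most the fraction `s^(d(n-1))` of the
cones; compare the complements and let `s → 1`.

As `∑ V_k ≥ A` and `∑ |a_k|² = 1`, the sum is at least `(n-1)A - A = (n-2)A ≥ n-2`.

Both facts rest on one monotonicity property, `RadiallyDecreasing.lintegral_pi`: averaging a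
radially decreasing function over independent uniform points of discs keeps it radially decreasing.
Statements about sections follow from statements about thin slabs `|⟨a,x⟩| ≤ ε` as `ε → 0`. -/

/-! ### Euclidean volume as a product measure. -/

/-- Fubini for an orthogonal splitting. It is used twice: to split the whole space along `a`, and to
split `a^⊥` along the coordinate `x_k`. -/
theorem measurePreserving_of_orthogonal_isometries {V W F : Type*}
    [NormedAddCommGroup V] [InnerProductSpace ℝ V] [FiniteDimensional ℝ V] [MeasurableSpace V]
    [BorelSpace V]
    [NormedAddCommGroup W] [InnerProductSpace ℝ W] [FiniteDimensional ℝ W] [MeasurableSpace W]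
    [BorelSpace W]
    [NormedAddCommGroup F] [InnerProductSpace ℝ F] [FiniteDimensional ℝ F] [MeasurableSpace F]
    [BorelSpace F] (i : W →ₗᵢ[ℝ] V) (j : F →ₗᵢ[ℝ] V) (horth : ∀ w u, inner ℝ (i w) (j u) = 0)
    (hspan : ∀ x, ∃ w u, x = i w + j u) :
    finrank ℝ W + finrank ℝ F = finrank ℝ V ∧
    MeasurePreserving (fun p : F × W ↦ i p.2 + j p.1) (volume.prod volume) volume := by
  let L : WithLp 2 (F × W) →ₗ[ℝ] V :=
    (i.toLinearMap.comp (LinearMap.snd ℝ F W) + j.toLinearMap.comp (LinearMap.fst ℝ F W)).comp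
      (WithLp.linearEquiv 2 ℝ (F × W)).toLinearMap
  have hL : ∀ p, L p = i p.snd + j p.fst := fun p ↦ rfl
  let Li : WithLp 2 (F × W) →ₗᵢ[ℝ] V := ⟨L, fun p ↦ by
    rw [← sq_eq_sq₀ (norm_nonneg _) (norm_nonneg _), hL, @norm_add_sq_real, horth,
      WithLp.prod_norm_sq_eq_of_L2, i.norm_map, j.norm_map]
    ring⟩
  have hsurj : Function.Surjective Li := fun x ↦ by
    obtain ⟨w, u, rfl⟩ := hspan x
    exact ⟨WithLp.toLp 2 (u, w), rfl⟩
  let Le := LinearIsometryEquiv.ofSurjective Li hsurj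
  refine ⟨?_, ?_⟩
  · rw [← Le.toLinearEquiv.finrank_eq, (WithLp.linearEquiv 2 ℝ (F × W)).finrank_eq,
      finrank_prod, add_comm]
  · exact Le.measurePreserving.comp (WithLp.volume_preserving_toLp F W)

theorem PiLp.measurePreserving_ofLp_volume {ι F : Type*} [Fintype ι]
    [NormedAddCommGroup F] [InnerProductSpace ℝ F] [FiniteDimensional ℝ F] [MeasurableSpace F]
    [BorelSpace F] :
    MeasurePreserving (WithLp.ofLp : PiLp 2 (fun _ : ι ↦ F) → ι → F) volume
      (Measure.pi fun _ ↦ volume) := by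
  classical
  refine ⟨by fun_prop, ?_⟩
  let B : ι → OrthonormalBasis _ ℝ F := fun _ ↦ stdOrthonormalBasis ℝ F
  rw [← (Pi.orthonormalBasis B).addHaar_eq_volume, Pi.orthonormalBasis.toBasis]
  have h := Basis.map_addHaar ((Pi.basis fun i : ι ↦ (B i).toBasis).map
    (WithLp.linearEquiv 2 ℝ (ι → F)).symm) (PiLp.continuousLinearEquiv 2 ℝ (fun _ : ι ↦ F))
  have h2 : ((Pi.basis fun i : ι ↦ (B i).toBasis).map
    (WithLp.linearEquiv 2 ℝ (ι → F)).symm).map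
      (PiLp.continuousLinearEquiv 2 ℝ (fun _ : ι ↦ F)).toLinearEquiv
      = Pi.basis fun i : ι ↦ (B i).toBasis := by
    ext; rfl
  rw [h2] at h
  refine h.trans ?_
  rw [Basis.addHaar_eq_iff]
  have h3 : ((Pi.basis fun i : ι ↦ (B i).toBasis).parallelepiped : Set (ι → F)) =
      Set.univ.pi fun i ↦ parallelepiped (B i) := by
    rw [Basis.coe_parallelepiped, parallelepiped_basis_eq]
    ext x
    simp only [Set.mem_ofPred_eq, Set.mem_univ_pi, Sigma.forall, Pi.basis_repr]
    refine forall_congr' fun i ↦ ?_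
    rw [← (B i).coe_toBasis, parallelepiped_basis_eq]
    rfl
  rw [h3, Measure.pi_pi]
  exact Finset.prod_eq_one fun i _ ↦ (B i).volume_parallelepiped

/-! ### Radially decreasing functions and translated balls. -/

/-- A function that decreases with the norm. -/
def RadiallyDecreasing {V : Type*} [Norm V] (φ : V → ENNReal) : Prop :=
  ∀ y z, ‖y‖ ≤ ‖z‖ → φ z ≤ φ y

/-- The reflection `τ` in the bisecting hyperplane of `y` and `z` exchanges the two balls, hence
their set differences. It brings the points nearer to `z` closer to the origin, because the origin
lies on the side of `y`. -/
theorem RadiallyDecreasing.setLIntegral_closedBall_le {V : Type*} [NormedAddCommGroup V]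
    [InnerProductSpace ℝ V] [FiniteDimensional ℝ V] [MeasurableSpace V] [BorelSpace V]
    {φ : V → ENNReal} (hφ : RadiallyDecreasing φ) {y z : V} (hyz : ‖y‖ ≤ ‖z‖) (R : ℝ) :
    ∫⁻ x in Metric.closedBall z R, φ x ≤ ∫⁻ x in Metric.closedBall y R, φ x := by
  rcases eq_or_ne y z with rfl | hne
  · rfl
  set e := z - y with he
  have he0 : e ≠ 0 := sub_ne_zero.2 hne.symm
  have he2 : 0 < ‖e‖ ^ 2 := by positivity
  set m := (2⁻¹ : ℝ) • (y + z) with hm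
  set r := (ℝ ∙ e)ᗮ.reflection with hr
  have hrx : ∀ v, r v = v - (2 * (inner ℝ e v / ‖e‖ ^ 2)) • e := fun v ↦ by
    rw [hr, Submodule.reflection_orthogonal_apply, Submodule.reflection_apply,
      Submodule.starProjection_singleton]
    simp only [RCLike.ofReal_real_eq_id, id_eq]
    module
  let τ : V ≃ᵐ V := ((MeasurableEquiv.subRight m).trans r.toMeasurableEquiv).trans
    (MeasurableEquiv.addRight m)
  have hτ : ∀ p, τ p = r (p - m) + m := fun p ↦ rfl
  have hτm : MeasurePreserving τ volume volume :=
    (measurePreserving_add_right volume m).comp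
      (r.measurePreserving.comp (measurePreserving_sub_right volume m))
  have hzm : z - m = (2⁻¹ : ℝ) • e := by rw [hm, he]; module
  have hym : y - m = -((2⁻¹ : ℝ) • e) := by rw [hm, he]; module
  have hre : r e = -e := by
    rw [hrx, real_inner_self_eq_norm_sq, div_self he2.ne']; module
  have hτz : τ z = y := by
    rw [hτ, hzm, map_smul, hre, smul_neg, ← hym]; abel
  have hτy : τ y = z := by
    rw [hτ, hym, map_neg, map_smul, hre, smul_neg, neg_neg, ← hzm]; abel
  have hdist : ∀ p q, dist (τ p) (τ q) = dist p q := fun p q ↦ by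
    rw [hτ, hτ, dist_add_right, r.dist_map, dist_sub_right]
  have hpre : τ ⁻¹' (Metric.closedBall y R \ Metric.closedBall z R) =
      Metric.closedBall z R \ Metric.closedBall y R := by
    ext p
    simp only [Set.mem_preimage, Set.mem_sdiff, Metric.mem_closedBall]
    rw [← hdist p z, ← hdist p y, hτz, hτy]
  have hle : ∀ p ∈ Metric.closedBall z R \ Metric.closedBall y R, φ p ≤ φ (τ p) := by
    intro p hp
    refine hφ _ _ ?_
    simp only [Set.mem_sdiff, Metric.mem_closedBall, not_le, dist_eq_norm] at hp
    have hlt : ‖p - z‖ ^ 2 < ‖p - y‖ ^ 2 := by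
      have := hp.1.trans_lt hp.2
      gcongr
    have hyz2 : ‖y‖ ^ 2 ≤ ‖z‖ ^ 2 := by gcongr
    have hc : 2 * inner ℝ e (p - m) = ‖p - y‖ ^ 2 - ‖p - z‖ ^ 2 := by
      have h1 : p - y = (p - m) + (2⁻¹ : ℝ) • e := by rw [hm, he]; module
      have h2 : p - z = (p - m) - (2⁻¹ : ℝ) • e := by rw [hm, he]; module
      rw [h1, h2, @norm_add_sq_real V, @norm_sub_sq_real V _ _ (p - m), inner_smul_right,
        real_inner_comm]
      ring
    have hmz : 2 * inner ℝ e m = ‖z‖ ^ 2 - ‖y‖ ^ 2 := by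
      rw [hm, he, inner_smul_right, inner_sub_left, inner_add_right, inner_add_right,
        real_inner_self_eq_norm_sq, real_inner_self_eq_norm_sq, real_inner_comm]
      ring
    set c := 2 * (inner ℝ e (p - m) / ‖e‖ ^ 2) with hcdef
    have hc0 : 0 ≤ c := by
      have : 0 ≤ inner ℝ e (p - m) := by linarith
      positivity
    have hce : c * ‖e‖ ^ 2 = 2 * inner ℝ e (p - m) := by
      rw [hcdef]; field_simp
    have hτp : τ p = p - c • e := by rw [hτ, hrx]; abel
    rw [← sq_le_sq₀ (norm_nonneg _) (norm_nonneg _), hτp, @norm_sub_sq_real, norm_smul,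
      inner_smul_right, mul_pow, Real.norm_eq_abs, sq_abs, real_inner_comm]
    have hsplit : (inner ℝ e (p - m) : ℝ) = inner ℝ e p - inner ℝ e m := inner_sub_right ..
    -- By `hce` and `hmz`, `‖p‖² - ‖τ p‖² = c (‖z‖² - ‖y‖²)`.
    nlinarith [mul_nonneg hc0 (sub_nonneg.2 hyz2)]
  have hmeas : MeasurableSet (Metric.closedBall z R \ Metric.closedBall y R) :=
    measurableSet_closedBall.diff measurableSet_closedBall
  have key : ∫⁻ x in Metric.closedBall z R \ Metric.closedBall y R, φ x ≤
      ∫⁻ x in Metric.closedBall y R \ Metric.closedBall z R, φ x := by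
    rw [← hτm.setLIntegral_comp_preimage_emb τ.measurableEmbedding φ
      (Metric.closedBall y R \ Metric.closedBall z R), hpre]
    exact setLIntegral_mono' hmeas hle
  rw [← lintegral_inter_add_sdiff φ (Metric.closedBall z R)
      (measurableSet_closedBall (x := y) (ε := R)),
    ← lintegral_inter_add_sdiff φ (Metric.closedBall y R)
      (measurableSet_closedBall (x := z) (ε := R)), Set.inter_comm]
  gcongr

/-! ### Sums of independent uniform variables in a disc. -/

section Disc

variable {𝕜 : Type*} [RCLike 𝕜] [MeasurableSpace 𝕜] [BorelSpace 𝕜]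

theorem RadiallyDecreasing.measurable {φ : 𝕜 → ENNReal} (hφ : RadiallyDecreasing φ) :
    Measurable φ := by
  have hg : Antitone fun r : ℝ ↦ φ ((max r 0 : ℝ) : 𝕜) := fun r s hrs ↦ hφ _ _ (by
    rw [RCLike.norm_ofReal, RCLike.norm_ofReal, abs_of_nonneg (le_max_right _ _),
      abs_of_nonneg (le_max_right _ _)]
    exact max_le_max_right _ hrs)
  have h : φ = (fun r : ℝ ↦ φ ((max r 0 : ℝ) : 𝕜)) ∘ fun z : 𝕜 ↦ ‖z‖ := by
    ext z
    have hz : ‖((max ‖z‖ 0 : ℝ) : 𝕜)‖ = ‖z‖ := by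
      rw [RCLike.norm_ofReal, abs_of_nonneg (le_max_right _ _), max_eq_left (norm_nonneg z)]
    exact le_antisymm (hφ _ _ hz.le) (hφ _ _ hz.ge)
  rw [h]
  exact hg.measurable.comp measurable_norm

theorem RadiallyDecreasing.comp_mul {𝕜 : Type*} [RCLike 𝕜] {φ : 𝕜 → ENNReal} (hφ : RadiallyDecreasing φ) (b : 𝕜) :
    RadiallyDecreasing fun z ↦ φ (b * z) := fun y z h ↦ hφ _ _ (by
  rw [norm_mul, norm_mul]; gcongr)

/-- Lebesgue measure restricted to the disc of radius `α`. -/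
noncomputable abbrev discMeasure (𝕜 : Type*) [RCLike 𝕜] [MeasurableSpace 𝕜] [BorelSpace 𝕜]
    (α : ℝ) : Measure 𝕜 :=
  volume.restrict (Metric.closedBall 0 α)

/-- For `b ≠ 0` a translation turns this into the integral of `φ (b * ·)` over the disc centred at
`b⁻¹ * y`, to which the comparison of translated balls applies. -/
theorem RadiallyDecreasing.lintegral_disc {φ : 𝕜 → ENNReal} (hφ : RadiallyDecreasing φ)
    (α : ℝ) (b : 𝕜) :
    RadiallyDecreasing fun y ↦ ∫⁻ t, φ (y + b * t) ∂discMeasure 𝕜 α := by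
  intro y z hyz
  rcases eq_or_ne b 0 with rfl | hb
  · simpa using mul_le_mul_left (hφ y z hyz) _
  have key : ∀ y : 𝕜, ∫⁻ t, φ (y + b * t) ∂discMeasure 𝕜 α =
      ∫⁻ t in Metric.closedBall (b⁻¹ * y) α, φ (b * t) := fun y ↦ by
    rw [← (measurePreserving_add_left volume (b⁻¹ * y)).setLIntegral_comp_preimage_emb
      (measurableEmbedding_addLeft _) (fun t ↦ φ (b * t))]
    have hpre : (fun t ↦ b⁻¹ * y + t) ⁻¹' Metric.closedBall (b⁻¹ * y) α =
        Metric.closedBall 0 α := by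
      ext t
      simp [dist_eq_norm]
    rw [hpre]
    refine lintegral_congr fun t ↦ ?_
    rw [mul_add, mul_inv_cancel_left₀ hb]
  simp only [key]
  refine (hφ.comp_mul b).setLIntegral_closedBall_le ?_ α
  rw [norm_mul, norm_mul]
  gcongr

theorem lintegral_pi_insertNth {𝕜 : Type*} [MeasurableSpace 𝕜] {n : ℕ} (μ : Measure 𝕜) [SigmaFinite μ] (i : Fin (n + 1))
    {f : (Fin (n + 1) → 𝕜) → ENNReal} (hf : Measurable f) :
    ∫⁻ x, f x ∂Measure.pi (fun _ ↦ μ) =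
      ∫⁻ t, ∫⁻ x, f (i.insertNth t x) ∂Measure.pi (fun _ : Fin n ↦ μ) ∂μ := by
  have h := (measurePreserving_piFinSuccAbove (fun _ : Fin (n + 1) ↦ μ) i).symm
  rw [← h.lintegral_comp hf]
  exact lintegral_prod _ (hf.comp h.measurable).aemeasurable

theorem sum_mul_insertNth {𝕜 : Type*} [RCLike 𝕜] {n : ℕ} (i : Fin (n + 1)) (b : Fin (n + 1) → 𝕜) (t : 𝕜)
    (x : Fin n → 𝕜) :
    ∑ j, b j * (i.insertNth t x : Fin (n + 1) → 𝕜) j =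
      b i * t + ∑ j, b (i.succAbove j) * x j := by
  rw [Fin.sum_univ_succAbove _ i]
  simp

/-- The law of `∑ b_j x_j` is radially decreasing for independent `x_j` uniform in a disc. -/
theorem RadiallyDecreasing.lintegral_pi {n : ℕ} {φ : 𝕜 → ENNReal} (hφ : RadiallyDecreasing φ)
    (α : ℝ) (b : Fin n → 𝕜) :
    RadiallyDecreasing fun y ↦
      ∫⁻ x, φ (y + ∑ j, b j * x j) ∂Measure.pi fun _ ↦ discMeasure 𝕜 α := by
  induction n with
  | zero =>
    intro y z hyz
    simpa using hφ y z hyz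
  | succ n ih =>
    have h := (ih fun j ↦ b ((0 : Fin (n + 1)).succAbove j)).lintegral_disc α (b 0)
    convert h using 2 with y
    have hm : Measurable fun x : Fin (n + 1) → 𝕜 ↦ φ (y + ∑ j, b j * x j) :=
      hφ.measurable.comp (by fun_prop)
    rw [lintegral_pi_insertNth _ 0 hm]
    simp only [sum_mul_insertNth, add_assoc]

theorem setLIntegral_closedBall_smul (α : ℝ) {r : ℝ} (hr : 0 < r) {f : 𝕜 → ENNReal}
    (hf : Measurable f) :
    ∫⁻ t in Metric.closedBall 0 (r * α), f t =
      ENNReal.ofReal (r ^ finrank ℝ 𝕜) * ∫⁻ t in Metric.closedBall 0 α, f (r • t) := by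
  have hmap := map_addHaar_smul (volume : Measure 𝕜) hr.ne'
  have hball : ∀ t : 𝕜, r • t ∈ Metric.closedBall 0 (r * α) ↔ t ∈ Metric.closedBall 0 α :=
    fun t ↦ by simp [norm_smul, abs_of_pos hr, hr]
  have hr' : 0 < r ^ finrank ℝ 𝕜 := by positivity
  have h1 : ∫⁻ t in Metric.closedBall 0 α, f (r • t) =
      ENNReal.ofReal |(r ^ finrank ℝ 𝕜)⁻¹| * ∫⁻ t in Metric.closedBall 0 (r * α), f t := by
    rw [← lintegral_indicator measurableSet_closedBall,
      ← lintegral_indicator measurableSet_closedBall, ← smul_eq_mul, ← lintegral_smul_measure,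
      ← hmap, lintegral_map (hf.indicator measurableSet_closedBall) (by fun_prop)]
    refine lintegral_congr fun t ↦ ?_
    by_cases ht : t ∈ Metric.closedBall (0 : 𝕜) α
    · rw [Set.indicator_of_mem ht, Set.indicator_of_mem ((hball t).2 ht)]
    · rw [Set.indicator_of_notMem ht, Set.indicator_of_notMem (mt (hball t).1 ht)]
  rw [h1, ← mul_assoc, abs_of_pos (inv_pos.2 hr'), ← ENNReal.ofReal_mul hr'.le,
    mul_inv_cancel₀ hr'.ne', ENNReal.ofReal_one, one_mul]

/-- Given `x i = t`, the probability that the sum is small is `Ψ (b i * t)`, which is radially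
decreasing in `t`. Rescaling the disc of radius `r * α` to radius `α` costs `r ^ d` and only
increases the integrand. -/
theorem le_measure_pi_of_smul_coordinate {n : ℕ} {α : ℝ} (hα : 0 ≤ α) (b : Fin n → 𝕜) (i : Fin n)
    (ε : ℝ) {r : ℝ} (hr : 0 < r) (hr1 : r ≤ 1) :
    ENNReal.ofReal (r ^ finrank ℝ 𝕜) *
      Measure.pi (fun _ ↦ discMeasure 𝕜 α) {x | ‖∑ j, b j * x j‖ ≤ ε} ≤
    Measure.pi (fun _ ↦ discMeasure 𝕜 α) {x | ‖∑ j, b j * x j‖ ≤ ε ∧ ‖x i‖ ≤ r * α} := by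
  obtain _ | n := n
  · exact i.elim0
  let ψ : 𝕜 → ENNReal := (Metric.closedBall (0 : 𝕜) ε).indicator 1
  have hψ : RadiallyDecreasing ψ := fun y z hyz ↦ by
    by_cases hz : ‖z‖ ≤ ε
    · simp [ψ, hz, hyz.trans hz]
    · simp [ψ, hz]
  let Ψ : 𝕜 → ENNReal := fun y ↦ ∫⁻ x, ψ (y + ∑ j, b (i.succAbove j) * x j)
    ∂Measure.pi fun _ ↦ discMeasure 𝕜 α
  have hΨ : RadiallyDecreasing Ψ := hψ.lintegral_pi α _
  have hSm : Measurable fun x : Fin (n + 1) → 𝕜 ↦ ‖∑ j, b j * x j‖ := by fun_prop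
  have hS : MeasurableSet {x : Fin (n + 1) → 𝕜 | ‖∑ j, b j * x j‖ ≤ ε} :=
    measurableSet_le hSm measurable_const
  have hT : MeasurableSet {x : Fin (n + 1) → 𝕜 | ‖∑ j, b j * x j‖ ≤ ε ∧ ‖x i‖ ≤ r * α} :=
    hS.inter (measurableSet_le (measurable_pi_apply i).norm measurable_const)
  have h1 : Measure.pi (fun _ ↦ discMeasure 𝕜 α) {x | ‖∑ j, b j * x j‖ ≤ ε} =
      ∫⁻ t in Metric.closedBall 0 α, Ψ (b i * t) := by
    rw [← lintegral_indicator_one hS, lintegral_pi_insertNth _ i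
      (f := {x : Fin (n + 1) → 𝕜 | ‖∑ j, b j * x j‖ ≤ ε}.indicator 1) (measurable_one.indicator hS)]
    refine lintegral_congr fun t ↦ lintegral_congr fun x ↦ ?_
    simp only [Set.indicator, Set.mem_ofPred_eq, sum_mul_insertNth, ψ, mem_closedBall_zero_iff,
      Pi.one_apply]
  have h2 : Measure.pi (fun _ ↦ discMeasure 𝕜 α) {x | ‖∑ j, b j * x j‖ ≤ ε ∧ ‖x i‖ ≤ r * α} =
      ∫⁻ t in Metric.closedBall 0 (r * α), Ψ (b i * t) := by
    rw [← lintegral_indicator_one hT, lintegral_pi_insertNth _ i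
      (f := {x : Fin (n + 1) → 𝕜 | ‖∑ j, b j * x j‖ ≤ ε ∧ ‖x i‖ ≤ r * α}.indicator 1)
      (measurable_one.indicator hT),
      ← Set.inter_eq_left.2 (Metric.closedBall_subset_closedBall
        (mul_le_of_le_one_left hα hr1) : Metric.closedBall (0 : 𝕜) (r * α) ⊆ _),
      ← Measure.restrict_restrict measurableSet_closedBall,
      ← lintegral_indicator (measurableSet_closedBall (x := 0) (ε := r * α))]
    refine lintegral_congr fun t ↦ ?_
    by_cases ht : ‖t‖ ≤ r * α
    · rw [Set.indicator_of_mem (mem_closedBall_zero_iff.2 ht)]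
      refine lintegral_congr fun x ↦ ?_
      simp [Set.indicator, sum_mul_insertNth, ψ, ht]
    · rw [Set.indicator_of_notMem (mt mem_closedBall_zero_iff.1 ht)]
      simp [Set.indicator, ht]
  rw [h1, h2, setLIntegral_closedBall_smul α hr (hΨ.comp_mul (b i)).measurable]
  gcongr with t
  refine hΨ.comp_mul (b i) _ _ ?_
  rw [norm_smul, Real.norm_of_nonneg hr.le]
  exact mul_le_of_le_one_left (norm_nonneg t) hr1

/-- Double counting of pairs at distance at most `ε`. As `ε → 0` it bounds `ν` on centred balls by
its density at 0 times Lebesgue measure, without a density having to be constructed. -/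
theorem measure_closedBall_le_of_le_center (ν : Measure 𝕜) [SFinite ν] {ε r : ℝ}
    (h : ∀ t, ν (Metric.closedBall t ε) ≤ ν (Metric.closedBall 0 ε)) :
    volume (Metric.closedBall (0 : 𝕜) ε) * ν (Metric.closedBall 0 r) ≤
      volume (Metric.closedBall (0 : 𝕜) (r + ε)) * ν (Metric.closedBall 0 ε) := by
  let S : Set (𝕜 × 𝕜) := {p | dist p.2 p.1 ≤ ε}
  have hS : MeasurableSet S := measurableSet_le (by fun_prop) measurable_const
  have hswap : ∫⁻ t in Metric.closedBall 0 (r + ε), ν (Metric.closedBall t ε) =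
      ∫⁻ s, volume.restrict (Metric.closedBall 0 (r + ε)) (Metric.closedBall s ε) ∂ν := by
    have h1 := Measure.prod_apply (μ := volume.restrict (Metric.closedBall (0 : 𝕜) (r + ε)))
      (ν := ν) hS
    have h2 := Measure.prod_apply_symm (μ := volume.restrict (Metric.closedBall (0 : 𝕜) (r + ε)))
      (ν := ν) hS
    refine (h1.symm.trans h2).trans (lintegral_congr fun s ↦ ?_)
    congr 1
    ext t
    simp [S, dist_comm]
  calc volume (Metric.closedBall (0 : 𝕜) ε) * ν (Metric.closedBall 0 r)
      = ∫⁻ s in Metric.closedBall 0 r, volume (Metric.closedBall s ε) ∂ν := by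
        simp [addHaar_closedBall_center]
    _ = ∫⁻ s in Metric.closedBall 0 r,
          volume.restrict (Metric.closedBall 0 (r + ε)) (Metric.closedBall s ε) ∂ν := by
        refine setLIntegral_congr_fun measurableSet_closedBall fun s hs ↦ ?_
        rw [Measure.restrict_apply measurableSet_closedBall, Set.inter_eq_left.2]
        refine Metric.closedBall_subset_closedBall' ?_
        rw [Metric.mem_closedBall] at hs
        linarith
    _ ≤ ∫⁻ t in Metric.closedBall 0 (r + ε), ν (Metric.closedBall t ε) := by
        rw [hswap]
        exact setLIntegral_le_lintegral _ _
    _ ≤ ∫⁻ t in Metric.closedBall (0 : 𝕜) (r + ε), ν (Metric.closedBall 0 ε) := by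
        exact lintegral_mono h
    _ = _ := by simp [mul_comm]

/-- The cross term vanishes by the symmetry `t ↦ -t`; averaging with the parallelogram law keeps
every integrand nonnegative. -/
theorem lintegral_enorm_add_mul_sq {α : ℝ} (hα : volume (Metric.closedBall (0 : 𝕜) α) = 1)
    (y b : 𝕜) :
    ∫⁻ t, ‖y + b * t‖ₑ ^ 2 ∂discMeasure 𝕜 α =
      ‖y‖ₑ ^ 2 + ‖b‖ₑ ^ 2 * ∫⁻ t, ‖t‖ₑ ^ 2 ∂discMeasure 𝕜 α := by
  have hneg : ∫⁻ t, ‖y + b * t‖ₑ ^ 2 ∂discMeasure 𝕜 α =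
      ∫⁻ t, ‖y - b * t‖ₑ ^ 2 ∂discMeasure 𝕜 α := by
    have h := (Measure.measurePreserving_neg (volume : Measure 𝕜)).setLIntegral_comp_preimage_emb
      (MeasurableEquiv.neg 𝕜).measurableEmbedding (fun t ↦ ‖y + b * t‖ₑ ^ 2)
      (Metric.closedBall 0 α)
    have hpre : Neg.neg ⁻¹' Metric.closedBall (0 : 𝕜) α = Metric.closedBall 0 α := by
      ext; simp
    rw [hpre] at h
    rw [← h]
    simp [sub_eq_add_neg]
  have hpar : ∀ u v : 𝕜, ‖u + v‖ₑ ^ 2 + ‖u - v‖ₑ ^ 2 = 2 * (‖u‖ₑ ^ 2 + ‖v‖ₑ ^ 2) := by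
    intro u v
    have := parallelogram_law_with_norm 𝕜 u v
    simp only [← ofReal_norm]
    rw [← ENNReal.ofReal_pow (by positivity), ← ENNReal.ofReal_pow (by positivity),
      ← ENNReal.ofReal_pow (by positivity), ← ENNReal.ofReal_pow (by positivity),
      ← ENNReal.ofReal_add (by positivity) (by positivity),
      ← ENNReal.ofReal_add (by positivity) (by positivity), this,
      ENNReal.ofReal_mul (by positivity)]
    simp
  have h2 : 2 * ∫⁻ t, ‖y + b * t‖ₑ ^ 2 ∂discMeasure 𝕜 α =
      2 * (‖y‖ₑ ^ 2 + ‖b‖ₑ ^ 2 * ∫⁻ t, ‖t‖ₑ ^ 2 ∂discMeasure 𝕜 α) := by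
    conv_lhs => rw [two_mul]; rhs; rw [hneg]
    rw [← lintegral_add_left (by fun_prop)]
    simp only [hpar, enorm_mul, mul_pow]
    rw [lintegral_const_mul _ (by fun_prop), lintegral_add_left (by fun_prop),
      lintegral_const_mul _ (by fun_prop)]
    simp [hα]
  exact (ENNReal.mul_right_inj (by simp) (by simp)).1 h2

theorem lintegral_pi_enorm_sum_sq {α : ℝ} (hα : volume (Metric.closedBall (0 : 𝕜) α) = 1)
    {n : ℕ} (b : Fin n → 𝕜) (y : 𝕜) :
    ∫⁻ x, ‖y + ∑ j, b j * x j‖ₑ ^ 2 ∂Measure.pi (fun _ ↦ discMeasure 𝕜 α) =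
      ‖y‖ₑ ^ 2 + (∑ j, ‖b j‖ₑ ^ 2) * ∫⁻ t, ‖t‖ₑ ^ 2 ∂discMeasure 𝕜 α := by
  induction n generalizing y with
  | zero => simp
  | succ n ih =>
    have hm : Measurable fun x : Fin (n + 1) → 𝕜 ↦ ‖y + ∑ j, b j * x j‖ₑ ^ 2 := by fun_prop
    rw [lintegral_pi_insertNth _ 0 hm]
    simp only [sum_mul_insertNth, ← add_assoc, ih]
    rw [lintegral_add_right _ (by fun_prop), lintegral_enorm_add_mul_sq hα,
      Fin.sum_univ_succAbove _ 0]
    simp [hα, add_mul, add_assoc]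

/-- Test both laws against `g = max (α² - |t|²) 0`. Its superlevel sets are centred balls, so the
layer cake formula gives `∫ g dν ≤ A ∫ g`. On the other hand `α² ≤ g + |t|²`, with equality on the
disc, so equal second moments give `∫ g ≤ ∫ g dν`. -/
theorem one_le_of_measure_closedBall_le {α : ℝ} (hα0 : 0 < α)
    (hα : volume (Metric.closedBall (0 : 𝕜) α) = 1)
    (ν : Measure 𝕜) [IsProbabilityMeasure ν] {A : ENNReal}
    (hA : A ≠ ⊤) (h : ∀ r, ν (Metric.closedBall 0 r) ≤ A * volume (Metric.closedBall (0 : 𝕜) r))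
    (hM : ∫⁻ t, ‖t‖ₑ ^ 2 ∂ν = ∫⁻ t, ‖t‖ₑ ^ 2 ∂discMeasure 𝕜 α) : 1 ≤ A := by
  let g : 𝕜 → ℝ := fun t ↦ max (α ^ 2 - ‖t‖ ^ 2) 0
  have hgm : Measurable g := by fun_prop
  have hg0 : ∀ t, 0 ≤ g t := fun t ↦ le_max_right _ _
  have hlevel : ∀ u : ℝ, 0 < u → ν {t | u ≤ g t} ≤ A * volume {t : 𝕜 | u ≤ g t} := by
    intro u hu
    rcases le_or_gt u (α ^ 2) with hle | hlt
    · have : {t : 𝕜 | u ≤ g t} = Metric.closedBall 0 (√(α ^ 2 - u)) := by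
        ext t
        rw [mem_closedBall_zero_iff, Real.le_sqrt (norm_nonneg _) (by linarith)]
        simp only [g, Set.mem_ofPred_eq, le_max_iff, hu.not_ge, or_false]
        constructor <;> intro <;> linarith
      rw [this]
      exact h _
    · have : {t : 𝕜 | u ≤ g t} = ∅ := by
        ext t
        have := sq_nonneg ‖t‖
        simp only [g, Set.mem_ofPred_eq, le_max_iff, hu.not_ge, or_false,
          Set.mem_empty_iff_false, iff_false]
        linarith
      simp [this]
  have hle : ∫⁻ t, ENNReal.ofReal (g t) ∂ν ≤ A * ∫⁻ t : 𝕜, ENNReal.ofReal (g t) := by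
    rw [lintegral_eq_lintegral_meas_le ν (.of_forall hg0) hgm.aemeasurable,
      lintegral_eq_lintegral_meas_le volume (.of_forall hg0) hgm.aemeasurable,
      ← lintegral_const_mul' A _ hA]
    exact setLIntegral_mono' measurableSet_Ioi fun u hu ↦ hlevel u hu
  have hsum : ∀ t : 𝕜, ENNReal.ofReal (α ^ 2) ≤ ENNReal.ofReal (g t) + ‖t‖ₑ ^ 2 := fun t ↦ by
    rw [← ofReal_norm, ← ENNReal.ofReal_pow (norm_nonneg _),
      ← ENNReal.ofReal_add (hg0 t) (by positivity)]
    refine ENNReal.ofReal_le_ofReal ?_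
    have := le_max_left (α ^ 2 - ‖t‖ ^ 2) 0
    simp only [g]; linarith
  have hνint : ENNReal.ofReal (α ^ 2) ≤
      (∫⁻ t, ENNReal.ofReal (g t) ∂ν) + ∫⁻ t, ‖t‖ₑ ^ 2 ∂ν := by
    rw [← lintegral_add_left (by fun_prop)]
    calc ENNReal.ofReal (α ^ 2) = ∫⁻ t, ENNReal.ofReal (α ^ 2) ∂ν := by simp
      _ ≤ _ := lintegral_mono hsum
  have hgdisc : ∫⁻ t : 𝕜, ENNReal.ofReal (g t) = ∫⁻ t, ENNReal.ofReal (g t) ∂discMeasure 𝕜 α := by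
    rw [← lintegral_indicator measurableSet_closedBall]
    refine lintegral_congr fun t ↦ ?_
    by_cases ht : ‖t‖ ≤ α
    · rw [Set.indicator_of_mem (mem_closedBall_zero_iff.2 ht)]
    · rw [Set.indicator_of_notMem (mt mem_closedBall_zero_iff.1 ht)]
      have : α ^ 2 ≤ ‖t‖ ^ 2 := by have := (not_le.1 ht).le; gcongr
      simp [g, this]
  have hdisc : (∫⁻ t : 𝕜, ENNReal.ofReal (g t)) + ∫⁻ t, ‖t‖ₑ ^ 2 ∂discMeasure 𝕜 α =
      ENNReal.ofReal (α ^ 2) := by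
    rw [hgdisc, ← lintegral_add_left (by fun_prop)]
    calc _ = ∫⁻ t, ENNReal.ofReal (α ^ 2) ∂discMeasure 𝕜 α := by
          refine setLIntegral_congr_fun measurableSet_closedBall fun t ht ↦ ?_
          rw [mem_closedBall_zero_iff] at ht
          have h2 : ‖t‖ ^ 2 ≤ α ^ 2 := by gcongr
          rw [← ofReal_norm, ← ENNReal.ofReal_pow (norm_nonneg _),
            ← ENNReal.ofReal_add (hg0 t) (by positivity)]
          congr 1
          simp only [g]
          rw [max_eq_left (by linarith)]; ring
      _ = _ := by simp [hα]
  have hMtop : ∫⁻ t, ‖t‖ₑ ^ 2 ∂discMeasure 𝕜 α ≠ ⊤ :=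
    ne_top_of_le_ne_top ENNReal.ofReal_ne_top (le_add_self.trans hdisc.le)
  have hGtop : ∫⁻ t : 𝕜, ENNReal.ofReal (g t) ≠ ⊤ :=
    ne_top_of_le_ne_top ENNReal.ofReal_ne_top (le_self_add.trans hdisc.le)
  have hG0 : ∫⁻ t : 𝕜, ENNReal.ofReal (g t) ≠ 0 := by
    intro h0
    rw [lintegral_eq_zero_iff (by fun_prop)] at h0
    have hc : Continuous fun t : 𝕜 ↦ ENNReal.ofReal (g t) :=
      ENNReal.continuous_ofReal.comp (by fun_prop)
    have := congr_fun ((hc.ae_eq_iff_eq volume continuous_zero).1 h0) 0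
    simp [g, not_le.2 (pow_pos hα0 2)] at this
  rw [hM, ← hdisc] at hνint
  have := ((ENNReal.add_le_add_iff_right hMtop).1 hνint).trans hle
  nth_rewrite 1 [← one_mul (∫⁻ t : 𝕜, ENNReal.ofReal (g t))] at this
  exact (ENNReal.mul_le_mul_iff_left hG0 hGtop).1 this

end Disc

/-! ### Sections by `a^⊥` as limits of thin slabs. -/

section Hyperplane

variable {𝕜 : Type*} [RCLike 𝕜] {n : ℕ}

theorem EuclideanSpace.real_inner_eq_re (x y : EuclideanSpace 𝕜 (Fin n)) :
    inner ℝ x y = RCLike.re (inner 𝕜 x y) := by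
  rw [PiLp.inner_apply, PiLp.inner_apply, _root_.map_sum]
  rfl

/-- The hyperplane `a^⊥` as a real subspace. -/
noncomputable def orthogonalHyperplane (a : EuclideanSpace 𝕜 (Fin n)) :
    Submodule ℝ (EuclideanSpace 𝕜 (Fin n)) where
  carrier := {x | inner 𝕜 a x = 0}
  zero_mem' := inner_zero_right a
  add_mem' {x y} hx hy := by
    simp only [Set.mem_ofPred_eq] at *
    rw [inner_add_right, hx, hy, add_zero]
  smul_mem' c x hx := by
    simp only [Set.mem_ofPred_eq] at *
    rw [RCLike.real_smul_eq_coe_smul (K := 𝕜), inner_smul_right, hx, mul_zero]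

theorem mem_orthogonalHyperplane {a x : EuclideanSpace 𝕜 (Fin n)} :
    x ∈ orthogonalHyperplane a ↔ inner 𝕜 a x = 0 := Iff.rfl

/-- The `𝕜`-line through a unit vector, as a real isometry. -/
noncomputable def lineIsometry (a : EuclideanSpace 𝕜 (Fin n)) (ha : ‖a‖ = 1) :
    𝕜 →ₗᵢ[ℝ] EuclideanSpace 𝕜 (Fin n) where
  toFun t := t • a
  map_add' s t := add_smul s t a
  map_smul' c t := smul_assoc c t a
  norm_map' t := by
    change ‖t • a‖ = ‖t‖
    rw [norm_smul, ha, mul_one]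

theorem norm_apply_le_one {a : EuclideanSpace 𝕜 (Fin n)} (ha : ‖a‖ = 1) (k : Fin n) :
    ‖a k‖ ≤ 1 := ha ▸ PiLp.norm_apply_le a k

theorem inner_toLp_eq_sum (a : EuclideanSpace 𝕜 (Fin n)) (x : Fin n → 𝕜) :
    inner 𝕜 a (WithLp.toLp 2 x) = ∑ j, star (a j) * x j := by
  simp [PiLp.inner_apply, mul_comm]

/-- The box with prescribed bounds on the moduli of the coordinates. -/
def box (𝕜 : Type*) [RCLike 𝕜] {n : ℕ} (r : Fin n → ℝ) : Set (EuclideanSpace 𝕜 (Fin n)) :=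
  {x | ∀ k, ‖x k‖ ≤ r k}

theorem cube_eq_box (α : ℝ) : cube 𝕜 n α = box 𝕜 fun _ ↦ α := rfl

variable [MeasurableSpace 𝕜] [BorelSpace 𝕜]

/-- The volume of `a^⊥` as a real inner product space (not the restriction of the volume of the
ambient space). -/
noncomputable def hyperplaneMeasure (a : EuclideanSpace 𝕜 (Fin n)) :
    Measure (orthogonalHyperplane a) :=
  @volume _ measureSpaceOfInnerProductSpace

instance (a : EuclideanSpace 𝕜 (Fin n)) : IsAddHaarMeasure (hyperplaneMeasure a) :=
  inferInstanceAs (IsAddHaarMeasure (@volume (orthogonalHyperplane a)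
    measureSpaceOfInnerProductSpace))

theorem orthogonalHyperplane_fubini {a : EuclideanSpace 𝕜 (Fin n)} (ha : ‖a‖ = 1) :
    finrank ℝ (orthogonalHyperplane a) + finrank ℝ 𝕜 = finrank ℝ (EuclideanSpace 𝕜 (Fin n)) ∧
    MeasurePreserving (fun p : 𝕜 × orthogonalHyperplane a ↦
      (p.2 : EuclideanSpace 𝕜 (Fin n)) + p.1 • a) (volume.prod (hyperplaneMeasure a)) volume := by
  have haa : inner 𝕜 a a = 1 := by rw [inner_self_eq_norm_sq_to_K, ha]; simp
  have horth : ∀ (w : orthogonalHyperplane a) (u : 𝕜),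
      inner ℝ ((orthogonalHyperplane a).subtypeₗᵢ w) (lineIsometry a ha u) = 0 := fun w u ↦ by
    rw [EuclideanSpace.real_inner_eq_re]
    change RCLike.re (inner 𝕜 (w : EuclideanSpace 𝕜 (Fin n)) (u • a)) = 0
    rw [inner_smul_right, inner_eq_zero_symm.1 w.2, mul_zero, _root_.map_zero]
  have hspan : ∀ x, ∃ (w : orthogonalHyperplane a) (u : 𝕜),
      x = (orthogonalHyperplane a).subtypeₗᵢ w + lineIsometry a ha u := fun x ↦ by
    have hmem : x - (inner 𝕜 a x : 𝕜) • a ∈ orthogonalHyperplane a := by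
      rw [mem_orthogonalHyperplane, inner_sub_right, inner_smul_right, haa, mul_one, sub_self]
    exact ⟨⟨_, hmem⟩, inner 𝕜 a x, (sub_add_cancel _ _).symm⟩
  have h := @measurePreserving_of_orthogonal_isometries (EuclideanSpace 𝕜 (Fin n))
    (orthogonalHyperplane a) 𝕜 _ _ _ _ _ _ _ _ _ _ _ _ _ _ _
    (orthogonalHyperplane a).subtypeₗᵢ (lineIsometry a ha)
  exact h horth hspan

theorem finrank_orthogonalHyperplane {a : EuclideanSpace 𝕜 (Fin n)} (ha : ‖a‖ = 1) :
    finrank ℝ (orthogonalHyperplane a) = finrank ℝ 𝕜 * (n - 1) := by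
  have h := (orthogonalHyperplane_fubini ha).1
  have h2 : finrank ℝ (EuclideanSpace 𝕜 (Fin n)) = n * finrank ℝ 𝕜 := by
    rw [(WithLp.linearEquiv 2 ℝ (Fin n → 𝕜)).finrank_eq, finrank_pi_fintype]
    simp
  rw [h2] at h
  rw [Nat.mul_sub, mul_one, mul_comm]
  omega

theorem measurableSet_box (r : Fin n → ℝ) : MeasurableSet (box 𝕜 r) := by
  have : box 𝕜 r = ⋂ k, {x | ‖x k‖ ≤ r k} := by ext; simp [box]
  rw [this]
  exact MeasurableSet.iInter fun k ↦ measurableSet_le (by fun_prop) measurable_const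

/-- The volume of the section of a set by the hyperplane `a^⊥`. -/
noncomputable def sectionVolume (a : EuclideanSpace 𝕜 (Fin n))
    (C : Set (EuclideanSpace 𝕜 (Fin n))) : ENNReal :=
  hyperplaneMeasure a (((↑) : orthogonalHyperplane a → EuclideanSpace 𝕜 (Fin n)) ⁻¹' C)

theorem volume_slab_eq {a : EuclideanSpace 𝕜 (Fin n)} (ha : ‖a‖ = 1) (r : Fin n → ℝ) (ε : ℝ) :
    volume (box 𝕜 r ∩ {x | ‖(inner 𝕜 a x : 𝕜)‖ ≤ ε}) =
      ∫⁻ t in Metric.closedBall (0 : 𝕜) ε, hyperplaneMeasure a {w : orthogonalHyperplane a |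
        (w : EuclideanSpace 𝕜 (Fin n)) + t • a ∈ box 𝕜 r} := by
  have haa : inner 𝕜 a a = 1 := by rw [inner_self_eq_norm_sq_to_K, ha]; simp
  have hmeas : MeasurableSet (box 𝕜 r ∩ {x | ‖(inner 𝕜 a x : 𝕜)‖ ≤ ε}) :=
    (measurableSet_box r).inter (measurableSet_le (by fun_prop) measurable_const)
  have hfub := (orthogonalHyperplane_fubini ha).2
  rw [← hfub.measure_preimage hmeas.nullMeasurableSet, Measure.prod_apply (hfub.measurable hmeas),
    ← lintegral_indicator measurableSet_closedBall]
  refine lintegral_congr fun t ↦ ?_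
  have hin : ∀ w : orthogonalHyperplane a,
      inner 𝕜 a ((w : EuclideanSpace 𝕜 (Fin n)) + t • a) = t := fun w ↦ by
    rw [inner_add_right, inner_smul_right, haa, mem_orthogonalHyperplane.1 w.2, zero_add, mul_one]
  by_cases ht : ‖t‖ ≤ ε
  · rw [Set.indicator_of_mem (mem_closedBall_zero_iff.2 ht)]
    congr 1
    ext w
    simp [hin, ht]
  · rw [Set.indicator_of_notMem (mt mem_closedBall_zero_iff.1 ht)]
    convert measure_empty (μ := hyperplaneMeasure a)
    ext w
    simp [hin, ht]

/-- For `‖t‖ ≤ ε`, translation by `t • a` moves each coordinate by at most `ε ≤ (ε / ρ) * r k`. Each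
parallel section therefore projects into the central one dilated by `1 + ε / ρ`; `le_volume_slab`
uses the dilation by `1 - ε / ρ` in the same way. -/
theorem volume_slab_le {a : EuclideanSpace 𝕜 (Fin n)} (ha : ‖a‖ = 1) {r : Fin n → ℝ} {ρ ε : ℝ}
    (hρ : 0 < ρ) (hr : ∀ k, ρ ≤ r k) (hε : 0 < ε) :
    volume (box 𝕜 r ∩ {x | ‖(inner 𝕜 a x : 𝕜)‖ ≤ ε}) ≤
      volume (Metric.closedBall (0 : 𝕜) ε) *
        (ENNReal.ofReal ((1 + ε / ρ) ^ finrank ℝ (orthogonalHyperplane a)) *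
          sectionVolume a (box 𝕜 r)) := by
  have hc : 0 < 1 + ε / ρ := by positivity
  rw [volume_slab_eq ha, mul_comm (volume (Metric.closedBall (0 : 𝕜) ε)), ← setLIntegral_const]
  refine setLIntegral_mono measurable_const fun t ht ↦ ?_
  rw [mem_closedBall_zero_iff] at ht
  have h := addHaar_smul (hyperplaneMeasure a) (1 + ε / ρ)
    (((↑) : orthogonalHyperplane a → EuclideanSpace 𝕜 (Fin n)) ⁻¹' box 𝕜 r)
  rw [abs_of_pos (by positivity)] at h
  rw [sectionVolume, ← h]
  refine measure_mono fun w hw ↦ ?_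
  rw [Set.mem_smul_set_iff_inv_smul_mem₀ hc.ne']
  intro k
  have hwk : ‖(w : EuclideanSpace 𝕜 (Fin n)) k + t * a k‖ ≤ r k := hw k
  have h1 : ‖(w : EuclideanSpace 𝕜 (Fin n)) k‖ ≤ r k + ε := by
    have h2 : ‖t * a k‖ ≤ ε := by
      rw [norm_mul]
      exact (mul_le_of_le_one_right (norm_nonneg t) (norm_apply_le_one ha k)).trans ht
    have h3 := norm_sub_le ((w : EuclideanSpace 𝕜 (Fin n)) k + t * a k) (t * a k)
    rw [add_sub_cancel_right] at h3
    linarith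
  change ‖(1 + ε / ρ)⁻¹ • (w : EuclideanSpace 𝕜 (Fin n)) k‖ ≤ r k
  rw [norm_smul, norm_inv, Real.norm_of_nonneg hc.le, inv_mul_le_iff₀ hc]
  have : ε ≤ ε / ρ * r k := by
    rw [div_mul_eq_mul_div, le_div_iff₀ hρ]
    exact mul_le_mul_of_nonneg_left (hr k) hε.le
  linarith

theorem le_volume_slab {a : EuclideanSpace 𝕜 (Fin n)} (ha : ‖a‖ = 1) {r : Fin n → ℝ} {ρ ε : ℝ}
    (hρ : 0 < ρ) (hr : ∀ k, ρ ≤ r k) (hε : 0 < ε) (hερ : ε < ρ) :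
    volume (Metric.closedBall (0 : 𝕜) ε) *
        (ENNReal.ofReal ((1 - ε / ρ) ^ finrank ℝ (orthogonalHyperplane a)) *
          sectionVolume a (box 𝕜 r)) ≤
    volume (box 𝕜 r ∩ {x | ‖(inner 𝕜 a x : 𝕜)‖ ≤ ε}) := by
  have hc : 0 < 1 - ε / ρ := by rw [sub_pos, div_lt_one hρ]; exact hερ
  rw [volume_slab_eq ha, mul_comm (volume (Metric.closedBall (0 : 𝕜) ε)), ← setLIntegral_const]
  refine setLIntegral_mono' measurableSet_closedBall fun t ht ↦ ?_
  rw [mem_closedBall_zero_iff] at ht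
  have h := addHaar_smul (hyperplaneMeasure a) (1 - ε / ρ)
    (((↑) : orthogonalHyperplane a → EuclideanSpace 𝕜 (Fin n)) ⁻¹' box 𝕜 r)
  rw [abs_of_pos (by positivity)] at h
  rw [sectionVolume, ← h]
  refine measure_mono ?_
  rintro _ ⟨w, hw, rfl⟩ k
  have hwk : ‖(w : EuclideanSpace 𝕜 (Fin n)) k‖ ≤ r k := hw k
  change ‖(1 - ε / ρ) • (w : EuclideanSpace 𝕜 (Fin n)) k + t * a k‖ ≤ r k
  have h2 : ‖t * a k‖ ≤ ε := by
    rw [norm_mul]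
    exact (mul_le_of_le_one_right (norm_nonneg t) (norm_apply_le_one ha k)).trans ht
  have h3 := norm_add_le ((1 - ε / ρ) • (w : EuclideanSpace 𝕜 (Fin n)) k) (t * a k)
  rw [norm_smul, Real.norm_of_nonneg hc.le] at h3
  have : ε ≤ ε / ρ * r k := by
    rw [div_mul_eq_mul_div, le_div_iff₀ hρ]
    exact mul_le_mul_of_nonneg_left (hr k) hε.le
  nlinarith

theorem measure_pi_disc_eq_volume {α : ℝ} {P : EuclideanSpace 𝕜 (Fin n) → Prop}
    (hP : MeasurableSet {x | P x}) :
    Measure.pi (fun _ ↦ discMeasure 𝕜 α) {x : Fin n → 𝕜 | P (WithLp.toLp 2 x)} =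
      volume (cube 𝕜 n α ∩ {x | P x}) := by
  have hP' : MeasurableSet {x : Fin n → 𝕜 | P (WithLp.toLp 2 x)} :=
    (by fun_prop : Measurable fun x : Fin n → 𝕜 ↦ WithLp.toLp 2 x) hP
  have hC : MeasurableSet (Set.univ.pi fun _ : Fin n ↦ Metric.closedBall (0 : 𝕜) α) :=
    MeasurableSet.univ_pi fun _ ↦ measurableSet_closedBall
  rw [← Measure.restrict_pi_pi, Measure.restrict_apply hP',
    ← PiLp.measurePreserving_ofLp_volume.measure_preimage (hP'.inter hC).nullMeasurableSet]
  congr 1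
  ext x
  simp [cube, and_comm]

theorem sectionVolume_box_ne_top (a : EuclideanSpace 𝕜 (Fin n)) (r : Fin n → ℝ) :
    sectionVolume a (box 𝕜 r) ≠ ⊤ := by
  have hsub : ((↑) : orthogonalHyperplane a → EuclideanSpace 𝕜 (Fin n)) ⁻¹' box 𝕜 r ⊆
      Metric.closedBall 0 (√(∑ k, r k ^ 2)) := fun w hw ↦ by
    rw [mem_closedBall_zero_iff]
    change ‖(w : EuclideanSpace 𝕜 (Fin n))‖ ≤ _
    rw [EuclideanSpace.norm_eq]
    refine Real.sqrt_le_sqrt (Finset.sum_le_sum fun k _ ↦ ?_)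
    have := hw k
    gcongr
  exact ne_top_of_le_ne_top measure_closedBall_lt_top.ne (measure_mono hsub)

/-- Here `ν` is the law of `⟨a,x⟩` on the cube. Its balls of radius `ε` have the largest mass when
centred at 0, and the slab estimate identifies the limiting bound on its density as the section
volume. Its second moment is that of the disc because `∑ |a_j|² = 1`. -/
theorem one_le_sectionVolume_cube {α : ℝ} (hα0 : 0 < α)
    (hα : volume (Metric.closedBall (0 : 𝕜) α) = 1) {a : EuclideanSpace 𝕜 (Fin n)}
    (ha : ‖a‖ = 1) : 1 ≤ sectionVolume a (cube 𝕜 n α) := by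
  have hprob : IsProbabilityMeasure (discMeasure 𝕜 α) := ⟨by simp [hα]⟩
  let S : (Fin n → 𝕜) → 𝕜 := fun x ↦ ∑ j, star (a j) * x j
  have hS : Measurable S := by fun_prop
  let ν : Measure 𝕜 := (Measure.pi fun _ ↦ discMeasure 𝕜 α).map S
  have hν : IsProbabilityMeasure ν := Measure.isProbabilityMeasure_map hS.aemeasurable
  have hνball : ∀ r, ν (Metric.closedBall 0 r) =
      volume (cube 𝕜 n α ∩ {x | ‖(inner 𝕜 a x : 𝕜)‖ ≤ r}) := fun r ↦ by
    rw [Measure.map_apply hS measurableSet_closedBall, ← measure_pi_disc_eq_volume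
      (measurableSet_le (by fun_prop) measurable_const)]
    congr 1
    ext x
    simp only [Set.mem_preimage, mem_closedBall_zero_iff, Set.mem_ofPred_eq, inner_toLp_eq_sum, S]
  have hcenter : ∀ ε t, ν (Metric.closedBall t ε) ≤ ν (Metric.closedBall 0 ε) := fun ε t ↦ by
    let ψ : 𝕜 → ENNReal := (Metric.closedBall (0 : 𝕜) ε).indicator 1
    have hψ : RadiallyDecreasing ψ := fun y z hyz ↦ by
      by_cases hz : ‖z‖ ≤ ε
      · simp [ψ, hz, hyz.trans hz]
      · simp [ψ, hz]
    have h : ∀ t, ν (Metric.closedBall t ε) =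
        ∫⁻ x, ψ (-t + ∑ j, star (a j) * x j) ∂Measure.pi fun _ ↦ discMeasure 𝕜 α := fun t ↦ by
      rw [Measure.map_apply hS measurableSet_closedBall,
        ← lintegral_indicator_one (hS measurableSet_closedBall)]
      refine lintegral_congr fun x ↦ ?_
      simp only [Set.indicator, Set.mem_preimage, Metric.mem_closedBall, dist_eq_norm, ψ, sub_zero,
        neg_add_eq_sub, S, Pi.one_apply]
    rw [h, h]
    refine hψ.lintegral_pi α _ _ _ ?_
    simp
  have hA := sectionVolume_box_ne_top a fun _ ↦ α
  refine one_le_of_measure_closedBall_le hα0 hα ν hA (fun r ↦ ?_) ?_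
  · rcases lt_or_ge r 0 with hr | hr
    · simp [Metric.closedBall_eq_empty.2 hr]
    have hbound : ∀ ε : ℝ, 0 < ε → ν (Metric.closedBall 0 r) ≤
        ENNReal.ofReal ((r + ε) ^ finrank ℝ 𝕜 *
          (1 + ε / α) ^ finrank ℝ (orthogonalHyperplane a)) *
        (volume (Metric.ball (0 : 𝕜) 1) * sectionVolume a (box 𝕜 fun _ ↦ α)) := fun ε hε ↦ by
      have h1 := measure_closedBall_le_of_le_center ν (r := r) (hcenter ε)
      have h2 := volume_slab_le (r := fun _ ↦ α) ha hα0 (fun _ ↦ le_rfl) hε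
      rw [← cube_eq_box, ← hνball] at h2
      have h3 := h1.trans (mul_le_mul_right h2 _)
      rw [mul_left_comm, ENNReal.mul_le_mul_iff_right
        (Metric.measure_closedBall_pos volume _ hε).ne' measure_closedBall_lt_top.ne,
        addHaar_closedBall volume _ (r := r + ε) (by positivity)] at h3
      refine h3.trans_eq ?_
      rw [ENNReal.ofReal_mul (by positivity), cube_eq_box]
      ring
    have htend : Filter.Tendsto (fun ε : ℝ ↦ ENNReal.ofReal ((r + ε) ^ finrank ℝ 𝕜 *
          (1 + ε / α) ^ finrank ℝ (orthogonalHyperplane a)) *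
        (volume (Metric.ball (0 : 𝕜) 1) * sectionVolume a (box 𝕜 fun _ ↦ α)))
        (nhdsWithin 0 (Set.Ioi 0)) (nhds (ENNReal.ofReal ((r + 0) ^ finrank ℝ 𝕜 *
          (1 + 0 / α) ^ finrank ℝ (orthogonalHyperplane a)) *
        (volume (Metric.ball (0 : 𝕜) 1) * sectionVolume a (box 𝕜 fun _ ↦ α)))) := by
      refine ENNReal.Tendsto.mul_const (ENNReal.tendsto_ofReal ?_)
        (.inr (ENNReal.mul_ne_top measure_ball_lt_top.ne hA))
      exact (Continuous.tendsto (by fun_prop) 0).mono_left nhdsWithin_le_nhds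
    have h := ge_of_tendsto htend (Filter.eventually_of_mem self_mem_nhdsWithin hbound)
    rw [addHaar_closedBall volume _ hr]
    refine h.trans_eq ?_
    simp only [add_zero, zero_div, one_pow, mul_one, cube_eq_box]
    ring
  · rw [lintegral_map (by fun_prop) hS]
    have h := lintegral_pi_enorm_sum_sq hα (fun j ↦ star (a j)) 0
    simp only [zero_add] at h
    rw [h]
    have hsum : ∑ j, ‖star (a j)‖ₑ ^ 2 = 1 := by
      simp only [← ofReal_norm, norm_star]
      simp_rw [← ENNReal.ofReal_pow (norm_nonneg _)]
      rw [← ENNReal.ofReal_sum_of_nonneg (fun _ _ ↦ by positivity), ← EuclideanSpace.norm_sq_eq,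
        ha]
      simp
    rw [hsum]
    simp

/-- This is `le_measure_pi_of_smul_coordinate` on the thin slab around `a^⊥`, divided by the volume
of the `ε`-ball, in the limit `ε → 0`. -/
theorem le_sectionVolume_slab {α : ℝ} (hα0 : 0 < α) {a : EuclideanSpace 𝕜 (Fin n)}
    (ha : ‖a‖ = 1) (i : Fin n) {s : ℝ} (hs : 0 < s) (hs1 : s ≤ 1) :
    ENNReal.ofReal (s ^ finrank ℝ 𝕜) * sectionVolume a (cube 𝕜 n α) ≤
      sectionVolume a (cube 𝕜 n α ∩ {x | ‖x i‖ ≤ s * α}) := by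
  have hbox : cube 𝕜 n α ∩ {x | ‖x i‖ ≤ s * α} =
      box 𝕜 (Function.update (fun _ ↦ α) i (s * α)) := by
    have hle : s * α ≤ α := mul_le_of_le_one_left hα0.le hs1
    ext x
    constructor
    · rintro ⟨hx, hxi⟩ k
      rcases eq_or_ne k i with rfl | hk
      · simpa using hxi
      · simpa [hk] using hx k
    · intro hx
      have hxi : ‖x i‖ ≤ s * α := by simpa using hx i
      refine ⟨fun k ↦ ?_, hxi⟩
      rcases eq_or_ne k i with rfl | hk
      · exact hxi.trans hle
      · simpa [hk] using hx k
  have hρ : 0 < s * α := by positivity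
  -- The smallest bound of the narrowed box is `s * α`, which serves as `ρ` in the slab estimate.
  have hr : ∀ k, s * α ≤ Function.update (fun _ ↦ α) i (s * α) k := fun k ↦ by
    rcases eq_or_ne k i with rfl | hk
    · simp
    · simpa [hk] using mul_le_of_le_one_left hα0.le hs1
  have hA := sectionVolume_box_ne_top a fun _ ↦ α
  have hW := sectionVolume_box_ne_top a (Function.update (fun _ ↦ α) i (s * α))
  set m := finrank ℝ (orthogonalHyperplane a)
  have hbound : ∀ ε ∈ Set.Ioo 0 (s * α),
      ENNReal.ofReal (s ^ finrank ℝ 𝕜) * (ENNReal.ofReal ((1 - ε / α) ^ m) *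
        sectionVolume a (cube 𝕜 n α)) ≤
      ENNReal.ofReal ((1 + ε / (s * α)) ^ m) *
        sectionVolume a (box 𝕜 (Function.update (fun _ ↦ α) i (s * α))) := by
    rintro ε ⟨hε, hεs⟩
    have hεα : ε < α := hεs.trans_le (mul_le_of_le_one_left hα0.le hs1)
    have h1 := le_volume_slab (r := fun _ ↦ α) ha hα0 (fun _ ↦ le_rfl) hε hεα
    have h2 := volume_slab_le ha hρ hr hε
    have h3 := le_measure_pi_of_smul_coordinate hα0.le (fun j ↦ star (a j)) i ε hs hs1
    simp only [← inner_toLp_eq_sum] at h3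
    have e1 := measure_pi_disc_eq_volume (α := α)
      (P := fun x : EuclideanSpace 𝕜 (Fin n) ↦ ‖(inner 𝕜 a x : 𝕜)‖ ≤ ε)
      (measurableSet_le (by fun_prop) measurable_const)
    have e2 := measure_pi_disc_eq_volume (α := α)
      (P := fun x : EuclideanSpace 𝕜 (Fin n) ↦ ‖(inner 𝕜 a x : 𝕜)‖ ≤ ε ∧ ‖x i‖ ≤ s * α)
      (.inter (s₁ := {x : EuclideanSpace 𝕜 (Fin n) | ‖(inner 𝕜 a x : 𝕜)‖ ≤ ε})
        (s₂ := {x | ‖x i‖ ≤ s * α}) (measurableSet_le (by fun_prop) measurable_const)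
        (measurableSet_le (by fun_prop) measurable_const))
    have e3 : cube 𝕜 n α ∩ {x | ‖(inner 𝕜 a x : 𝕜)‖ ≤ ε ∧ ‖x i‖ ≤ s * α} =
        box 𝕜 (Function.update (fun _ ↦ α) i (s * α)) ∩ {x | ‖(inner 𝕜 a x : 𝕜)‖ ≤ ε} := by
      rw [← hbox]; ext; simp only [Set.mem_inter_iff, Set.mem_ofPred_eq]; tauto
    rw [e3] at e2
    rw [e1, e2] at h3
    have h4 := (mul_le_mul_right h1 _).trans (h3.trans h2)
    rwa [mul_left_comm, ENNReal.mul_le_mul_iff_right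
        (Metric.measure_closedBall_pos volume _ hε).ne' measure_closedBall_lt_top.ne] at h4
  have hleft : Filter.Tendsto (fun ε : ℝ ↦ ENNReal.ofReal (s ^ finrank ℝ 𝕜) *
      (ENNReal.ofReal ((1 - ε / α) ^ m) * sectionVolume a (cube 𝕜 n α)))
      (nhdsWithin 0 (Set.Ioi 0)) (nhds (ENNReal.ofReal (s ^ finrank ℝ 𝕜) *
      (ENNReal.ofReal ((1 - 0 / α) ^ m) * sectionVolume a (cube 𝕜 n α)))) := by
    refine ENNReal.Tendsto.const_mul (ENNReal.Tendsto.mul_const (ENNReal.tendsto_ofReal ?_)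
      (.inr hA)) (.inr ENNReal.ofReal_ne_top)
    exact (Continuous.tendsto (by fun_prop) 0).mono_left nhdsWithin_le_nhds
  have hright : Filter.Tendsto (fun ε : ℝ ↦ ENNReal.ofReal ((1 + ε / (s * α)) ^ m) *
        sectionVolume a (box 𝕜 (Function.update (fun _ ↦ α) i (s * α))))
      (nhdsWithin 0 (Set.Ioi 0)) (nhds (ENNReal.ofReal ((1 + 0 / (s * α)) ^ m) *
        sectionVolume a (box 𝕜 (Function.update (fun _ ↦ α) i (s * α))))) := by
    refine ENNReal.Tendsto.mul_const (ENNReal.tendsto_ofReal ?_) (.inr hW)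
    exact (Continuous.tendsto (by fun_prop) 0).mono_left nhdsWithin_le_nhds
  have h := le_of_tendsto_of_tendsto hleft hright
    (Filter.eventually_of_mem (Ioo_mem_nhdsGT hρ) hbound)
  rw [hbox]
  simpa using h

end Hyperplane

/-! ### Cones over the faces and their volumes. -/

section Cone

variable {𝕜 : Type*} [RCLike 𝕜] {n : ℕ}

/-- The points whose `k`-th coordinate is the first one of maximal modulus. -/
def maxCone (𝕜 : Type*) [RCLike 𝕜] {n : ℕ} (k : Fin n) : Set (EuclideanSpace 𝕜 (Fin n)) :=
  {x | (∀ j, ‖x j‖ ≤ ‖x k‖) ∧ ∀ j < k, ‖x j‖ < ‖x k‖}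

theorem exists_mem_maxCone [NeZero n] (x : EuclideanSpace 𝕜 (Fin n)) : ∃ k, x ∈ maxCone 𝕜 k := by
  classical
  let s : Finset (Fin n) := Finset.univ.filter fun k ↦ ∀ j, ‖x j‖ ≤ ‖x k‖
  have hs : s.Nonempty := by
    obtain ⟨k, -, hk⟩ := Finset.exists_max_image Finset.univ (fun j ↦ ‖x j‖) ⟨0, Finset.mem_univ _⟩
    exact ⟨k, by simpa [s] using hk⟩
  have hmem : ∀ j, ‖x j‖ ≤ ‖x (s.min' hs)‖ := by simpa [s] using s.min'_mem hs
  refine ⟨s.min' hs, hmem, fun j hj ↦ (hmem j).lt_of_ne fun heq ↦ ?_⟩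
  have hjs : j ∈ s := by simpa [s, heq] using hmem
  exact (s.min'_le j hjs).not_gt hj

theorem disjoint_maxCone {k l : Fin n} (hkl : k ≠ l) : Disjoint (maxCone 𝕜 k) (maxCone 𝕜 l) := by
  rw [Set.disjoint_left]
  intro x hk hl
  rcases lt_or_gt_of_ne hkl with h | h
  · exact (hl.2 k h).not_ge (hk.1 l)
  · exact (hk.2 l h).not_ge (hl.1 k)

theorem smul_mem_maxCone {k : Fin n} {x : EuclideanSpace 𝕜 (Fin n)} {s : ℝ} (hs : 0 < s)
    (hx : x ∈ maxCone 𝕜 k) : s • x ∈ maxCone 𝕜 k := by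
  have hn : ∀ j, ‖(s • x) j‖ = s * ‖x j‖ := fun j ↦ by
    rw [PiLp.smul_apply, norm_smul, Real.norm_of_nonneg hs.le]
  refine ⟨fun j ↦ ?_, fun j hj ↦ ?_⟩
  · rw [hn, hn]; exact mul_le_mul_of_nonneg_left (hx.1 j) hs.le
  · rw [hn, hn]; exact mul_lt_mul_of_pos_left (hx.2 j hj) hs

variable [MeasurableSpace 𝕜] [BorelSpace 𝕜]

theorem measurableSet_maxCone (k : Fin n) : MeasurableSet (maxCone 𝕜 k) := by
  have : maxCone 𝕜 k = (⋂ j, {x | ‖x j‖ ≤ ‖x k‖}) ∩ ⋂ j, ⋂ _ : j < k, {x | ‖x j‖ < ‖x k‖} := by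
    ext; simp [maxCone]
  rw [this]
  exact (MeasurableSet.iInter fun j ↦ measurableSet_le (by fun_prop) (by fun_prop)).inter
    (MeasurableSet.iInter fun j ↦ MeasurableSet.iInter fun _ ↦
      measurableSet_lt (by fun_prop) (by fun_prop))

theorem sectionVolume_mono (a : EuclideanSpace 𝕜 (Fin n)) {C D : Set (EuclideanSpace 𝕜 (Fin n))}
    (h : C ⊆ D) : sectionVolume a C ≤ sectionVolume a D :=
  measure_mono (Set.preimage_mono h)

theorem sectionVolume_cube_le_sum [NeZero n] (α : ℝ) (a : EuclideanSpace 𝕜 (Fin n)) :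
    sectionVolume a (cube 𝕜 n α) ≤ ∑ k, sectionVolume a (cube 𝕜 n α ∩ maxCone 𝕜 k) := by
  have h : cube 𝕜 n α ⊆ ⋃ k, cube 𝕜 n α ∩ maxCone 𝕜 k := fun x hx ↦ by
    obtain ⟨k, hk⟩ := exists_mem_maxCone x
    exact Set.mem_iUnion.2 ⟨k, hx, hk⟩
  refine (sectionVolume_mono a h).trans ?_
  rw [sectionVolume, Set.preimage_iUnion, ← tsum_fintype (L := .unconditional _)]
  exact measure_iUnion_le _

/-- Comparing the cone over the `k`-th faces with the slab `|x_k| ≤ s α`. -/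
theorem sectionVolume_cone_add_le {α : ℝ} (hα0 : 0 < α) {a : EuclideanSpace 𝕜 (Fin n)}
    (ha : ‖a‖ = 1) (k : Fin n) {s : ℝ} (hs : 0 < s) (hs1 : s ≤ 1) :
    sectionVolume a (cube 𝕜 n α ∩ maxCone 𝕜 k) +
        ENNReal.ofReal (s ^ finrank ℝ 𝕜) * sectionVolume a (cube 𝕜 n α) ≤
      sectionVolume a (cube 𝕜 n α) + ENNReal.ofReal (s ^ (finrank ℝ 𝕜 * (n - 1))) *
        sectionVolume a (cube 𝕜 n α ∩ maxCone 𝕜 k) := by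
  set K := cube 𝕜 n α ∩ maxCone 𝕜 k with hK
  set T : Set (EuclideanSpace 𝕜 (Fin n)) := {x | ‖x k‖ ≤ s * α} with hT
  have hTm : MeasurableSet T := measurableSet_le (by fun_prop) measurable_const
  -- In the cone `x_k` dominates every coordinate, so `|x_k| ≤ s α` puts the point in `s K`; the
  -- dimension of `a^⊥` gives the exponent.
  have h1 : sectionVolume a (K ∩ T) ≤
      ENNReal.ofReal (s ^ (finrank ℝ 𝕜 * (n - 1))) * sectionVolume a K := by
    have h := addHaar_smul (hyperplaneMeasure a) s
      (((↑) : orthogonalHyperplane a → EuclideanSpace 𝕜 (Fin n)) ⁻¹' K)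
    rw [abs_of_pos (by positivity), finrank_orthogonalHyperplane ha] at h
    rw [sectionVolume, sectionVolume, ← h]
    refine measure_mono fun w hw ↦ ?_
    rw [Set.mem_smul_set_iff_inv_smul_mem₀ hs.ne']
    obtain ⟨⟨-, hcone⟩, hwT⟩ := hw
    refine ⟨fun j ↦ ?_, smul_mem_maxCone (inv_pos.2 hs) hcone⟩
    have hwj : ‖(w : EuclideanSpace 𝕜 (Fin n)) j‖ ≤ s * α := (hcone.1 j).trans hwT
    change ‖s⁻¹ • (w : EuclideanSpace 𝕜 (Fin n)) j‖ ≤ α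
    rwa [norm_smul, norm_inv, Real.norm_of_nonneg hs.le, inv_mul_le_iff₀ hs]
  have hsplit : ∀ C, sectionVolume a (C ∩ T) + sectionVolume a (C \ T) = sectionVolume a C :=
    fun C ↦ measure_inter_add_sdiff _ (measurable_subtype_coe hTm)
  have h2 := le_sectionVolume_slab hα0 ha k hs hs1
  calc sectionVolume a K + ENNReal.ofReal (s ^ finrank ℝ 𝕜) * sectionVolume a (cube 𝕜 n α)
      ≤ (ENNReal.ofReal (s ^ (finrank ℝ 𝕜 * (n - 1))) * sectionVolume a K +
          sectionVolume a (cube 𝕜 n α \ T)) + sectionVolume a (cube 𝕜 n α ∩ T) := by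
        rw [← hsplit K]
        gcongr
        · rwa [hsplit K]
        · exact sectionVolume_mono a (Set.sdiff_subset_sdiff_left Set.inter_subset_left)
    _ = _ := by rw [← hsplit (cube 𝕜 n α)]; ring

/-- With `q = s ^ d` the comparison reads `(1 - q ^ (n - 1)) v ≤ (1 - q) A`. Dividing by `1 - q`
leaves a geometric sum, which tends to `n - 1` as `s → 1`. -/
theorem mul_sectionVolume_cone_le {α : ℝ} (hα0 : 0 < α) {a : EuclideanSpace 𝕜 (Fin n)}
    (ha : ‖a‖ = 1) (k : Fin n) :
    ((n - 1 : ℕ) : ℝ) * (sectionVolume a (cube 𝕜 n α ∩ maxCone 𝕜 k)).toReal ≤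
      (sectionVolume a (cube 𝕜 n α)).toReal := by
  have hA : sectionVolume a (cube 𝕜 n α) ≠ ⊤ := sectionVolume_box_ne_top a fun _ ↦ α
  have hV : sectionVolume a (cube 𝕜 n α ∩ maxCone 𝕜 k) ≠ ⊤ :=
    ne_top_of_le_ne_top hA (sectionVolume_mono a Set.inter_subset_left)
  set A := (sectionVolume a (cube 𝕜 n α)).toReal
  set v := (sectionVolume a (cube 𝕜 n α ∩ maxCone 𝕜 k)).toReal
  set d := finrank ℝ 𝕜
  have hd : d ≠ 0 := finrank_pos.ne'
  have hbound : ∀ s ∈ Set.Ioo (0 : ℝ) 1, (∑ i ∈ Finset.range (n - 1), (s ^ d) ^ i) * v ≤ A := by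
    rintro s ⟨hs, hs1⟩
    have h := sectionVolume_cone_add_le hα0 ha k hs hs1.le
    have h' := ENNReal.toReal_mono (by finiteness) h
    rw [ENNReal.toReal_add hV (by finiteness), ENNReal.toReal_add hA (by finiteness),
      ENNReal.toReal_mul, ENNReal.toReal_mul, ENNReal.toReal_ofReal (by positivity),
      ENNReal.toReal_ofReal (by positivity), pow_mul] at h'
    have hq : s ^ d < 1 := pow_lt_one₀ hs.le hs1 hd
    have hgeom := mul_neg_geom_sum (s ^ d) (n - 1)
    refine le_of_mul_le_mul_left ?_ (sub_pos.2 hq)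
    calc (1 - s ^ d) * ((∑ i ∈ Finset.range (n - 1), (s ^ d) ^ i) * v)
        = (1 - (s ^ d) ^ (n - 1)) * v := by rw [← mul_assoc, hgeom]
      _ ≤ (1 - s ^ d) * A := by linarith
  have htend : Filter.Tendsto (fun s : ℝ ↦ (∑ i ∈ Finset.range (n - 1), (s ^ d) ^ i) * v)
      (nhdsWithin 1 (Set.Iio 1)) (nhds ((∑ i ∈ Finset.range (n - 1), ((1 : ℝ) ^ d) ^ i) * v)) :=
    (Continuous.tendsto (by fun_prop) 1).mono_left nhdsWithin_le_nhds
  have h := le_of_tendsto htend (Filter.eventually_of_mem (Ioo_mem_nhdsLT zero_lt_one) hbound)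
  simpa using h

/-- The weights `‖a k‖²` sum to 1, so the subtracted part is at most `A`, while the cones cover the
section; what remains is `(n - 2) A` with `A ≥ 1`. -/
theorem le_sum_mul_sectionVolume_cone {α : ℝ} (hα0 : 0 < α)
    (hα : volume (Metric.closedBall (0 : 𝕜) α) = 1) {a : EuclideanSpace 𝕜 (Fin n)}
    (ha : ‖a‖ = 1) (hn : 2 ≤ n) :
    (n : ℝ) - 2 ≤ ∑ k, (1 - ‖a k‖ ^ 2) *
      (((n - 1 : ℕ) : ℝ) * (sectionVolume a (cube 𝕜 n α ∩ maxCone 𝕜 k)).toReal) := by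
  have : NeZero n := ⟨by omega⟩
  have hA : sectionVolume a (cube 𝕜 n α) ≠ ⊤ := sectionVolume_box_ne_top a fun _ ↦ α
  have hV : ∀ k, sectionVolume a (cube 𝕜 n α ∩ maxCone 𝕜 k) ≠ ⊤ := fun k ↦
    ne_top_of_le_ne_top hA (sectionVolume_mono a Set.inter_subset_left)
  have h1 : 1 ≤ (sectionVolume a (cube 𝕜 n α)).toReal := by
    simpa using ENNReal.toReal_mono hA (one_le_sectionVolume_cube hα0 hα ha)
  have h2 := ENNReal.toReal_mono (ENNReal.sum_ne_top.2 fun k _ ↦ hV k)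
    (sectionVolume_cube_le_sum α a)
  rw [ENNReal.toReal_sum fun k _ ↦ hV k] at h2
  have h3 := mul_sectionVolume_cone_le hα0 ha
  set A := (sectionVolume a (cube 𝕜 n α)).toReal
  have hnorm : ∑ k, ‖a k‖ ^ 2 = 1 := by rw [← EuclideanSpace.norm_sq_eq, ha, one_pow]
  have hcast : ((n - 1 : ℕ) : ℝ) = n - 1 := by rw [Nat.cast_sub (by omega), Nat.cast_one]
  have hn' : (2 : ℝ) ≤ n := by exact_mod_cast hn
  have h4 : ∑ k, ‖a k‖ ^ 2 *
      (((n - 1 : ℕ) : ℝ) * (sectionVolume a (cube 𝕜 n α ∩ maxCone 𝕜 k)).toReal) ≤ A := by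
    calc _ ≤ ∑ k, ‖a k‖ ^ 2 * A := Finset.sum_le_sum fun k _ ↦
          mul_le_mul_of_nonneg_left (h3 k) (by positivity)
      _ = A := by rw [← Finset.sum_mul, hnorm, one_mul]
  simp only [sub_mul, one_mul, Finset.sum_sub_distrib]
  rw [← Finset.mul_sum, hcast] at *
  nlinarith [mul_le_mul_of_nonneg_left h2 (by linarith : (0 : ℝ) ≤ n - 1)]

end Cone

/-! ### Slices of a cone at a fixed value of one coordinate. -/

section Face

variable {𝕜 : Type*} [RCLike 𝕜] {n : ℕ}

/-- The points of `a^⊥` with vanishing `k`-th coordinate. -/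
noncomputable def faceSpace (a : EuclideanSpace 𝕜 (Fin n)) (k : Fin n) :
    Submodule ℝ (EuclideanSpace 𝕜 (Fin n)) where
  carrier := {x | inner 𝕜 a x = 0 ∧ x k = 0}
  zero_mem' := ⟨inner_zero_right a, rfl⟩
  add_mem' {x y} hx hy :=
    ⟨(orthogonalHyperplane a).add_mem hx.1 hy.1, by
      rw [PiLp.add_apply, hx.2, hy.2, add_zero]⟩
  smul_mem' c x hx :=
    ⟨(orthogonalHyperplane a).smul_mem c hx.1, by rw [PiLp.smul_apply, hx.2, smul_zero]⟩

/-- The inclusion of `faceSpace a k` in `a^⊥`. -/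
noncomputable def faceInclusion (a : EuclideanSpace 𝕜 (Fin n)) (k : Fin n) :
    faceSpace a k →ₗᵢ[ℝ] orthogonalHyperplane a where
  toLinearMap := Submodule.inclusion fun _ hx ↦ hx.1
  norm_map' _ := rfl

/-- The unit vector of `a^⊥` orthogonal to `faceSpace a k`. -/
noncomputable def faceNormal (a : EuclideanSpace 𝕜 (Fin n)) (k : Fin n) :
    EuclideanSpace 𝕜 (Fin n) :=
  ((√(1 - ‖a k‖ ^ 2) : ℝ) : 𝕜)⁻¹ • (EuclideanSpace.single k 1 - star (a k) • a)

theorem inner_single_sub (a x : EuclideanSpace 𝕜 (Fin n)) (k : Fin n) :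
    inner 𝕜 (EuclideanSpace.single k 1 - star (a k) • a) x = x k - a k * inner 𝕜 a x := by
  rw [inner_sub_left, inner_smul_left, EuclideanSpace.inner_single_left]
  simp

theorem inner_faceNormal (a x : EuclideanSpace 𝕜 (Fin n)) (k : Fin n) :
    inner 𝕜 (faceNormal a k) x =
      ((√(1 - ‖a k‖ ^ 2) : ℝ) : 𝕜)⁻¹ * (x k - a k * inner 𝕜 a x) := by
  rw [faceNormal, inner_smul_left, inner_single_sub]
  simp

theorem inner_self_faceNormal {a : EuclideanSpace 𝕜 (Fin n)} (ha : ‖a‖ = 1) (k : Fin n) :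
    inner 𝕜 a (faceNormal a k) = 0 := by
  have haa : inner 𝕜 a a = 1 := by rw [inner_self_eq_norm_sq_to_K, ha]; simp
  rw [← inner_eq_zero_symm, inner_faceNormal, haa]
  simp

/-- A displacement `t` along the normal changes `x_k` by `√(1 - ‖a k‖²) • t`, the source of the
factor between cone volume and face volume. -/
theorem faceNormal_apply {a : EuclideanSpace 𝕜 (Fin n)} {k : Fin n} (hk : ‖a k‖ < 1) :
    faceNormal a k k = ((√(1 - ‖a k‖ ^ 2) : ℝ) : 𝕜) := by
  have hpos : 0 < 1 - ‖a k‖ ^ 2 := by nlinarith [norm_nonneg (a k)]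
  have hc : ((√(1 - ‖a k‖ ^ 2) : ℝ) : 𝕜) ≠ 0 := by
    rw [Ne, RCLike.ofReal_eq_zero]; exact (Real.sqrt_pos.2 hpos).ne'
  have h1 : star (a k) * a k = ((‖a k‖ ^ 2 : ℝ) : 𝕜) := by
    rw [RCLike.star_def, RCLike.conj_mul]; simp
  have h2 : ((√(1 - ‖a k‖ ^ 2) : ℝ) : 𝕜) * ((√(1 - ‖a k‖ ^ 2) : ℝ) : 𝕜) =
      1 - ((‖a k‖ ^ 2 : ℝ) : 𝕜) := by
    rw [← RCLike.ofReal_mul, Real.mul_self_sqrt hpos.le]; simp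
  rw [faceNormal, PiLp.smul_apply, PiLp.sub_apply, PiLp.smul_apply, smul_eq_mul, smul_eq_mul, h1,
    PiLp.single_apply, if_pos rfl, ← h2, inv_mul_cancel_left₀ hc]

theorem norm_faceNormal {a : EuclideanSpace 𝕜 (Fin n)} (ha : ‖a‖ = 1) {k : Fin n}
    (hk : ‖a k‖ < 1) : ‖faceNormal a k‖ = 1 := by
  have hpos : 0 < 1 - ‖a k‖ ^ 2 := by nlinarith [norm_nonneg (a k)]
  have hc : ((√(1 - ‖a k‖ ^ 2) : ℝ) : 𝕜) ≠ 0 := by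
    rw [Ne, RCLike.ofReal_eq_zero]; exact (Real.sqrt_pos.2 hpos).ne'
  have h : inner 𝕜 (faceNormal a k) (faceNormal a k) = 1 := by
    rw [inner_faceNormal, inner_self_faceNormal ha, mul_zero, sub_zero, faceNormal_apply hk,
      inv_mul_cancel₀ hc]
  have h2 : ‖faceNormal a k‖ ^ 2 = 1 := by
    rw [← inner_self_eq_norm_sq (𝕜 := 𝕜), h, RCLike.one_re]
  exact (pow_eq_one_iff_of_nonneg (norm_nonneg _) two_ne_zero).1 h2

/-- The `𝕜`-line in `a^⊥` spanned by `faceNormal a k`. -/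
noncomputable def faceLine {a : EuclideanSpace 𝕜 (Fin n)} (ha : ‖a‖ = 1) {k : Fin n}
    (hk : ‖a k‖ < 1) : 𝕜 →ₗᵢ[ℝ] orthogonalHyperplane a where
  toLinearMap := LinearMap.codRestrict _ (lineIsometry _ (norm_faceNormal ha hk)).toLinearMap
    fun t ↦ by
      change inner 𝕜 a (t • faceNormal a k) = 0
      rw [inner_smul_right, inner_self_faceNormal ha, mul_zero]
  norm_map' t := (lineIsometry _ (norm_faceNormal ha hk)).norm_map t

/-- The part of the section of the cube on which `x_k` is the first coordinate of maximal modulus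
and `x_k = t`. -/
def faceSlice (α : ℝ) (a : EuclideanSpace 𝕜 (Fin n)) (k : Fin n) (t : 𝕜) :
    Set (EuclideanSpace 𝕜 (Fin n)) :=
  {x | inner 𝕜 a x = 0 ∧ x ∈ cube 𝕜 n α ∩ maxCone 𝕜 k ∧ x k = t}

theorem disjoint_faceSlice {α : ℝ} {a : EuclideanSpace 𝕜 (Fin n)} {k l : Fin n} {t u : 𝕜}
    (h : k ≠ l ∨ t ≠ u) : Disjoint (faceSlice α a k t) (faceSlice α a l u) := by
  rw [Set.disjoint_left]
  rintro x ⟨-, hx, hxk⟩ ⟨-, hy, hyl⟩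
  rcases eq_or_ne k l with rfl | hkl
  · exact h.elim (fun h ↦ h rfl) fun h ↦ h (hxk.symm.trans hyl)
  · exact Set.disjoint_left.1 (disjoint_maxCone hkl) hx.2 hy.2

/-- A point with `|x_k| = α` is not interior, since its multiples by `s > 1` leave the cube. -/
theorem faceSlice_subset {α : ℝ} {a : EuclideanSpace 𝕜 (Fin n)} {k : Fin n} {t : 𝕜}
    (hα0 : 0 < α) (ht : ‖t‖ = α) : faceSlice α a k t ⊆ cubeBoundarySection α a := by
  rintro x ⟨hx, ⟨hcube, -⟩, hxk⟩
  refine ⟨⟨subset_closure hcube, fun hint ↦ ?_⟩, hx⟩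
  have hcont : Filter.Tendsto (fun s : ℝ ↦ s • x) (nhdsWithin 1 (Set.Ioi 1)) (nhds x) := by
    have h : Filter.Tendsto (fun s : ℝ ↦ s • x) (nhds 1) (nhds ((1 : ℝ) • x)) :=
      Continuous.tendsto (by fun_prop) 1
    rw [one_smul] at h
    exact h.mono_left nhdsWithin_le_nhds
  obtain ⟨s, hs, hs1⟩ := ((hcont.eventually (mem_interior_iff_mem_nhds.1 hint)).and
    self_mem_nhdsWithin).exists
  have h := hs k
  rw [PiLp.smul_apply, norm_smul, hxk, ht, Real.norm_of_nonneg (by linarith)] at h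
  nlinarith

variable [MeasurableSpace 𝕜] [BorelSpace 𝕜]

/-- The volume of `faceSpace a k` as a real inner product space. -/
noncomputable def faceMeasure (a : EuclideanSpace 𝕜 (Fin n)) (k : Fin n) :
    Measure (faceSpace a k) :=
  @volume _ measureSpaceOfInnerProductSpace

instance (a : EuclideanSpace 𝕜 (Fin n)) (k : Fin n) : IsAddHaarMeasure (faceMeasure a k) :=
  inferInstanceAs (IsAddHaarMeasure (@volume (faceSpace a k) measureSpaceOfInnerProductSpace))

theorem faceSpace_fubini {a : EuclideanSpace 𝕜 (Fin n)} (ha : ‖a‖ = 1) {k : Fin n}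
    (hk : ‖a k‖ < 1) :
    finrank ℝ (faceSpace a k) + finrank ℝ 𝕜 = finrank ℝ (orthogonalHyperplane a) ∧
    MeasurePreserving (fun p : 𝕜 × faceSpace a k ↦ faceInclusion a k p.2 + faceLine ha hk p.1)
      (volume.prod (faceMeasure a k)) (hyperplaneMeasure a) := by
  have hpos : 0 < 1 - ‖a k‖ ^ 2 := by nlinarith [norm_nonneg (a k)]
  have hc : ((√(1 - ‖a k‖ ^ 2) : ℝ) : 𝕜) ≠ 0 := by
    rw [Ne, RCLike.ofReal_eq_zero]; exact (Real.sqrt_pos.2 hpos).ne'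
  have horth : ∀ (w : faceSpace a k) (u : 𝕜),
      inner ℝ (faceInclusion a k w) (faceLine ha hk u) = 0 := fun w u ↦ by
    change inner ℝ (w : EuclideanSpace 𝕜 (Fin n)) (u • faceNormal a k) = 0
    have hw : inner 𝕜 (w : EuclideanSpace 𝕜 (Fin n)) (faceNormal a k) = 0 := by
      rw [← inner_eq_zero_symm, inner_faceNormal, w.2.1, w.2.2]
      simp
    rw [EuclideanSpace.real_inner_eq_re, inner_smul_right, hw, mul_zero, _root_.map_zero]
  have hspan : ∀ x, ∃ (w : faceSpace a k) (u : 𝕜),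
      x = faceInclusion a k w + faceLine ha hk u := fun x ↦ by
    set t : 𝕜 := ((√(1 - ‖a k‖ ^ 2) : ℝ) : 𝕜)⁻¹ * (x : EuclideanSpace 𝕜 (Fin n)) k with ht
    have hmem : (x : EuclideanSpace 𝕜 (Fin n)) - t • faceNormal a k ∈ faceSpace a k := by
      refine ⟨?_, ?_⟩
      · rw [inner_sub_right, inner_smul_right, inner_self_faceNormal ha, x.2, mul_zero, sub_zero]
      · rw [PiLp.sub_apply, PiLp.smul_apply, faceNormal_apply hk, smul_eq_mul, ht, mul_comm,
          mul_inv_cancel_left₀ hc, sub_self]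
    exact ⟨⟨_, hmem⟩, t, Subtype.ext (sub_add_cancel _ _).symm⟩
  have h := @measurePreserving_of_orthogonal_isometries (orthogonalHyperplane a)
    (faceSpace a k) 𝕜 _ _ _ _ _ _ _ _ _ _ _ _ _ _ _ (faceInclusion a k) (faceLine ha hk)
  exact h horth hspan

theorem finrank_faceSpace {a : EuclideanSpace 𝕜 (Fin n)} (ha : ‖a‖ = 1) {k : Fin n}
    (hk : ‖a k‖ < 1) : finrank ℝ (faceSpace a k) = finrank ℝ 𝕜 * (n - 2) := by
  have h := (faceSpace_fubini ha hk).1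
  rw [finrank_orthogonalHyperplane ha] at h
  rw [Nat.mul_sub, mul_one] at h
  rw [Nat.mul_sub]
  omega

theorem measurableSet_faceSlice (α : ℝ) (a : EuclideanSpace 𝕜 (Fin n)) (k : Fin n) (t : 𝕜) :
    MeasurableSet (faceSlice α a k t) := by
  have h1 : MeasurableSet {x : EuclideanSpace 𝕜 (Fin n) | (inner 𝕜 a x : 𝕜) = 0} :=
    measurableSet_eq_fun (by fun_prop) measurable_const
  have h2 : MeasurableSet {x : EuclideanSpace 𝕜 (Fin n) | x k = t} :=
    measurableSet_eq_fun (by fun_prop) measurable_const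
  exact h1.inter (((measurableSet_box fun _ ↦ α).inter (measurableSet_maxCone k)).inter h2)

/-- The volume of `faceSlice`. -/
noncomputable def faceVolume (α : ℝ) (a : EuclideanSpace 𝕜 (Fin n)) (k : Fin n) (t : 𝕜) :
    ENNReal :=
  Measure.euclideanHausdorffMeasure (finrank ℝ 𝕜 * (n - 2)) (faceSlice α a k t)

open scoped Pointwise in
-- Because `x_k` is dominant in the cone, the constraint of the cube on a slice reduces to `‖x_k‖ ≤
-- α`; slices along a ray are then dilates of each other.
theorem faceVolume_smul {α : ℝ} (a : EuclideanSpace 𝕜 (Fin n)) (k : Fin n) {t : 𝕜}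
    (ht : ‖t‖ = α) {r : ℝ} (hr : 0 < r) (hr1 : r ≤ 1) :
    faceVolume α a k (r • t) = ENNReal.ofReal (r ^ (finrank ℝ 𝕜 * (n - 2))) * faceVolume α a k t := by
  have hα0 : 0 ≤ α := ht ▸ norm_nonneg t
  have hset : faceSlice α a k (r • t) = r • faceSlice α a k t := by
    ext x
    rw [Set.mem_smul_set_iff_inv_smul_mem₀ hr.ne']
    constructor
    · rintro ⟨hx, ⟨-, hcone⟩, hxk⟩
      refine ⟨(orthogonalHyperplane a).smul_mem _ hx, ⟨fun j ↦ ?_,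
        smul_mem_maxCone (inv_pos.2 hr) hcone⟩, ?_⟩
      · rw [PiLp.smul_apply, norm_smul, norm_inv, Real.norm_of_nonneg hr.le, inv_mul_le_iff₀ hr]
        refine (hcone.1 j).trans ?_
        rw [hxk, norm_smul, Real.norm_of_nonneg hr.le, ht]
      · rw [PiLp.smul_apply, hxk, inv_smul_smul₀ hr.ne']
    · rintro ⟨hx, ⟨hcube, hcone⟩, hxk⟩
      have hsm : ∀ y : EuclideanSpace 𝕜 (Fin n), r • (r⁻¹ • y) = y := smul_inv_smul₀ hr.ne'
      rw [← hsm x]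
      refine ⟨(orthogonalHyperplane a).smul_mem _ hx, ⟨fun j ↦ ?_,
        smul_mem_maxCone hr hcone⟩, ?_⟩
      · rw [PiLp.smul_apply, norm_smul, Real.norm_of_nonneg hr.le]
        exact (mul_le_of_le_one_left (norm_nonneg _) hr1).trans (hcube j)
      · rw [PiLp.smul_apply, hxk]
  rw [faceVolume, hset, euclideanHausdorffMeasure_smul₀ _ hr.ne', faceVolume, ENNReal.smul_def,
    smul_eq_mul]
  congr 1
  rw [ENNReal.coe_pow, ENNReal.ofReal_pow hr.le]
  congr 1
  rw [← enorm_eq_nnnorm, Real.enorm_of_nonneg hr.le]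

theorem faceVolume_eq_zero {α : ℝ} (a : EuclideanSpace 𝕜 (Fin n)) (k : Fin n) {t : 𝕜}
    (ht : α < ‖t‖) : faceVolume α a k t = 0 := by
  have : faceSlice α a k t = ∅ := by
    ext x
    simp only [Set.mem_empty_iff_false, iff_false]
    rintro ⟨-, ⟨hcube, -⟩, hxk⟩
    exact (hcube k).not_gt (hxk ▸ ht)
  rw [faceVolume, this, measure_empty]

/-- The slice is an isometric translate of a subset of `faceSpace a k`, where Hausdorff measure is
volume. -/
theorem faceMeasure_eq_faceVolume {α : ℝ} {a : EuclideanSpace 𝕜 (Fin n)} (ha : ‖a‖ = 1) {k : Fin n}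
    (hk : ‖a k‖ < 1) (t : 𝕜) :
    faceMeasure a k {w | ((faceInclusion a k w + faceLine ha hk t : orthogonalHyperplane a) :
      EuclideanSpace 𝕜 (Fin n)) ∈ cube 𝕜 n α ∩ maxCone 𝕜 k} =
    faceVolume α a k (√(1 - ‖a k‖ ^ 2) • t) := by
  have hv : ∀ t, (t • faceNormal a k) k = √(1 - ‖a k‖ ^ 2) • t := fun t ↦ by
    rw [PiLp.smul_apply, faceNormal_apply hk, smul_eq_mul, mul_comm, RCLike.real_smul_eq_coe_mul]
  have hcoe : ∀ w : faceSpace a k, ((faceInclusion a k w + faceLine ha hk t :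
      orthogonalHyperplane a) : EuclideanSpace 𝕜 (Fin n)) = w + t • faceNormal a k := fun w ↦ rfl
  have hiso : Isometry fun w : faceSpace a k ↦
      (w : EuclideanSpace 𝕜 (Fin n)) + t • faceNormal a k :=
    (isometry_add_right (t • faceNormal a k)).comp isometry_subtype_coe
  rw [faceVolume, ← finrank_faceSpace ha hk, faceMeasure,
    ← @InnerProductSpace.euclideanHausdorffMeasure_eq_volume (faceSpace a k),
    ← hiso.euclideanHausdorffMeasure_image]
  congr 1
  ext x
  constructor
  · rintro ⟨w, hw, rfl⟩
    refine ⟨?_, hw, ?_⟩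
    · rw [inner_add_right, inner_smul_right, inner_self_faceNormal ha, w.2.1, mul_zero, add_zero]
    · rw [PiLp.add_apply, w.2.2, hv, zero_add]
  · rintro ⟨hx, hxK, hxk⟩
    have hmem : x - t • faceNormal a k ∈ faceSpace a k := by
      refine ⟨?_, ?_⟩
      · rw [inner_sub_right, inner_smul_right, inner_self_faceNormal ha, hx, mul_zero, sub_zero]
      · rw [PiLp.sub_apply, hv, hxk, sub_self]
    refine ⟨⟨_, hmem⟩, ?_, sub_add_cancel _ _⟩
    change x - t • faceNormal a k + t • faceNormal a k ∈ cube 𝕜 n α ∩ maxCone 𝕜 k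
    rwa [sub_add_cancel]

theorem measurable_faceVolume_and_lintegral_eq {α : ℝ} {a : EuclideanSpace 𝕜 (Fin n)} (ha : ‖a‖ = 1) {k : Fin n}
    (hk : ‖a k‖ < 1) : Measurable (faceVolume α a k) ∧
    ENNReal.ofReal (√(1 - ‖a k‖ ^ 2) ^ finrank ℝ 𝕜) *
      sectionVolume a (cube 𝕜 n α ∩ maxCone 𝕜 k) = ∫⁻ t, faceVolume α a k t := by
  have hpos : 0 < √(1 - ‖a k‖ ^ 2) := Real.sqrt_pos.2 (by nlinarith [norm_nonneg (a k)])
  set c := √(1 - ‖a k‖ ^ 2) with hc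
  have hK : MeasurableSet (((↑) : orthogonalHyperplane a → EuclideanSpace 𝕜 (Fin n)) ⁻¹'
      (cube 𝕜 n α ∩ maxCone 𝕜 k)) :=
    measurable_subtype_coe ((measurableSet_box fun _ ↦ α).inter (measurableSet_maxCone k))
  have hfub := (faceSpace_fubini ha hk).2
  have hm := measurable_measure_prodMk_left (ν := faceMeasure a k) (hfub.measurable hK)
  have hg : ∀ t, faceMeasure a k (Prod.mk t ⁻¹' ((fun p : 𝕜 × faceSpace a k ↦
      faceInclusion a k p.2 + faceLine ha hk p.1) ⁻¹' (((↑) : orthogonalHyperplane a →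
        EuclideanSpace 𝕜 (Fin n)) ⁻¹' (cube 𝕜 n α ∩ maxCone 𝕜 k)))) =
      faceVolume α a k (c • t) := faceMeasure_eq_faceVolume ha hk
  simp only [hg] at hm
  have hmeas : Measurable (faceVolume α a k) := by
    have h := hm.comp (measurable_const_smul (c⁻¹) : Measurable fun t : 𝕜 ↦ c⁻¹ • t)
    simpa [Function.comp_def, smul_inv_smul₀ hpos.ne'] using h
  refine ⟨hmeas, ?_⟩
  have hV : sectionVolume a (cube 𝕜 n α ∩ maxCone 𝕜 k) = ∫⁻ t, faceVolume α a k (c • t) := by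
    rw [sectionVolume, ← hfub.measure_preimage hK.nullMeasurableSet,
      Measure.prod_apply (hfub.measurable hK)]
    exact lintegral_congr hg
  rw [hV, ← lintegral_map hmeas (measurable_const_smul c), map_addHaar_smul volume hpos.ne',
    lintegral_smul_measure, smul_eq_mul, ← mul_assoc, abs_of_pos (by positivity),
    ← ENNReal.ofReal_mul (by positivity), mul_inv_cancel₀ (by positivity), ENNReal.ofReal_one,
    one_mul]

end Face

/-! ### Radial integration and the two perimeters. -/

section Assembly

theorem setLIntegral_Ioc_pow_div {β : ℝ} (hβ : 0 < β) (N : ℕ) :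
    ∫⁻ r in Set.Ioc 0 β, ENNReal.ofReal ((r / β) ^ N) = ENNReal.ofReal (β / (N + 1)) := by
  have hcont : Continuous fun r : ℝ ↦ (r / β) ^ N := by fun_prop
  rw [← ofReal_integral_eq_lintegral_ofReal]
  · congr 1
    rw [← intervalIntegral.integral_of_le hβ.le]
    simp only [div_pow]
    rw [intervalIntegral.integral_div, integral_pow]
    field_simp
    simp [pow_succ]
  · exact (hcont.integrableOn_Icc).mono_set Set.Ioc_subset_Icc_self
  · refine (ae_restrict_iff' measurableSet_Ioc).2 (.of_forall fun r hr ↦ ?_)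
    have := hr.1.le
    change 0 ≤ (r / β) ^ N
    positivity

/-- The cone formula: height times base over the dimension `N + 1`. -/
theorem setLIntegral_Ioi_of_homogeneous {β : ℝ} (hβ : 0 < β) (N : ℕ) (G : ℝ → ENNReal)
    (hG : ∀ t, 0 < t → t ≤ β → G t = ENNReal.ofReal ((t / β) ^ N) * G β)
    (hG0 : ∀ t, β < t → G t = 0) :
    ∫⁻ t in Set.Ioi 0, G t = ENNReal.ofReal (β / (N + 1)) * G β := by
  rw [← setLIntegral_Ioc_pow_div hβ, ← lintegral_mul_const _ (by fun_prop),
    ← lintegral_indicator measurableSet_Ioi, ← lintegral_indicator measurableSet_Ioc]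
  refine lintegral_congr fun t ↦ ?_
  by_cases h1 : 0 < t
  · by_cases h2 : t ≤ β
    · rw [Set.indicator_of_mem (Set.mem_Ioi.2 h1), Set.indicator_of_mem (Set.mem_Ioc.2 ⟨h1, h2⟩),
        hG t h1 h2]
    · rw [Set.indicator_of_mem (Set.mem_Ioi.2 h1), Set.indicator_of_notMem (fun h ↦ h2 h.2),
        hG0 t (not_le.1 h2)]
  · rw [Set.indicator_of_notMem (mt Set.mem_Ioi.1 h1), Set.indicator_of_notMem (fun h ↦ h1 h.1)]

theorem lintegral_real_eq_Ioi_add (G : ℝ → ENNReal) :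
    ∫⁻ t, G t = (∫⁻ t in Set.Ioi 0, G t) + ∫⁻ t in Set.Ioi 0, G (-t) := by
  rw [← lintegral_add_compl G (measurableSet_Ioi (a := (0 : ℝ))), Set.compl_Ioi,
    ← Measure.restrict_congr_set (Iio_ae_eq_Iic (a := (0 : ℝ)) (μ := volume)),
    ← (Measure.measurePreserving_neg (volume : Measure ℝ)).setLIntegral_comp_preimage_emb
      (MeasurableEquiv.neg ℝ).measurableEmbedding G (Set.Iio 0)]
  simp

theorem lintegral_complex_of_homogeneous {α : ℝ} (hα : 0 < α) (N : ℕ) {G : ℂ → ENNReal}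
    (hm : Measurable G)
    (hG : ∀ (r : ℝ) (t : ℂ), ‖t‖ = α → 0 < r → r ≤ 1 → G (r • t) = ENNReal.ofReal (r ^ N) * G t)
    (hG0 : ∀ t, α < ‖t‖ → G t = 0) :
    ∫⁻ t, G t = ENNReal.ofReal (α ^ 2 / (N + 2)) *
      ∫⁻ θ in Set.Ioo (-Real.pi) Real.pi, G ((α : ℂ) * Complex.exp (θ * Complex.I)) := by
  let g : ℝ → ENNReal := fun θ ↦ G ((α : ℂ) * Complex.exp (θ * Complex.I))
  have hgm : Measurable g := hm.comp (by fun_prop)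
  -- The polar Jacobian `r` times `(r / α) ^ N`, written as `α * (r / α) ^ (N + 1)`; this gives `N +
  -- 2` in the denominator.
  let f : ℝ → ENNReal := (Set.Ioc 0 α).indicator
    fun r ↦ ENNReal.ofReal α * ENNReal.ofReal ((r / α) ^ (N + 1))
  have hfm : Measurable f := Measurable.indicator (by fun_prop) measurableSet_Ioc
  have hf : ∫⁻ r in Set.Ioi 0, f r = ENNReal.ofReal (α ^ 2 / (N + 2)) := by
    rw [lintegral_indicator measurableSet_Ioc, Measure.restrict_restrict measurableSet_Ioc,
      Set.inter_eq_left.2 Set.Ioc_subset_Ioi_self, lintegral_const_mul _ (by fun_prop),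
      setLIntegral_Ioc_pow_div hα, ← ENNReal.ofReal_mul hα.le]
    congr 1
    push_cast
    ring
  rw [← Complex.lintegral_comp_polarCoord_symm, polarCoord_target, ← hf,
    ← lintegral_prod_mul hfm.aemeasurable hgm.aemeasurable, Measure.prod_restrict,
    ← volume_eq_prod]
  refine setLIntegral_congr_fun (measurableSet_Ioi.prod measurableSet_Ioo) ?_
  rintro ⟨r, θ⟩ ⟨hr, -⟩
  replace hr : 0 < r := hr
  have hexp : Complex.polarCoord.symm (r, θ) =
      (r / α) • ((α : ℂ) * Complex.exp (θ * Complex.I)) := by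
    rw [Complex.polarCoord_symm_apply, Complex.exp_mul_I, Complex.real_smul, ← mul_assoc,
      ← Complex.ofReal_mul, div_mul_cancel₀ _ hα.ne', Complex.ofReal_cos, Complex.ofReal_sin]
  have hnorm : ‖(α : ℂ) * Complex.exp (θ * Complex.I)‖ = α := by
    rw [norm_mul, Complex.norm_exp_ofReal_mul_I, mul_one, Complex.norm_real,
      Real.norm_of_nonneg hα.le]
  simp only [f, g]
  rw [hexp, smul_eq_mul]
  by_cases hle : r ≤ α
  · rw [Set.indicator_of_mem (Set.mem_Ioc.2 ⟨hr, hle⟩),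
      hG _ _ hnorm (by positivity) ((div_le_one hα).2 hle), ← mul_assoc,
      ← ENNReal.ofReal_mul hr.le, ← ENNReal.ofReal_mul hα.le, pow_succ]
    congr 2
    field_simp
  · rw [Set.indicator_of_notMem (fun h ↦ hle h.2), hG0, mul_zero, zero_mul]
    rw [norm_smul, hnorm, Real.norm_of_nonneg (by positivity), div_mul_cancel₀ _ hα.ne']
    exact not_le.1 hle

/-- Polar coordinates use phases in `(-π, π)`, the perimeter uses `[0, 2π)`. -/
theorem setLIntegral_periodic_eq {g : ℝ → ENNReal} (hg : Function.Periodic g (2 * Real.pi)) :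
    ∫⁻ θ in Set.Ico 0 (2 * Real.pi), g θ = ∫⁻ θ in Set.Ioo (-Real.pi) Real.pi, g θ := by
  have h := (isAddFundamentalDomain_Ioc Real.two_pi_pos 0).setLIntegral_eq
    (isAddFundamentalDomain_Ioc Real.two_pi_pos (-Real.pi)) g hg.map_vadd_zmultiples
  rw [zero_add, show -Real.pi + 2 * Real.pi = Real.pi by ring] at h
  rw [Measure.restrict_congr_set Ico_ae_eq_Ioc, h, Measure.restrict_congr_set Ioo_ae_eq_Ioc]

/-- Reduces both perimeters to one estimate per face. Nothing is asked when `‖a k‖ = 1`, where the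
weight `1 - ‖a k‖²` vanishes and the face normal is not available. -/
theorem ofReal_le_sum_faces {𝕜 : Type*} [RCLike 𝕜] [MeasurableSpace 𝕜] [BorelSpace 𝕜] {n : ℕ}
    (hn : 2 ≤ n) {α : ℝ} (hα0 : 0 < α) (hα : volume (Metric.closedBall (0 : 𝕜) α) = 1)
    {a : EuclideanSpace 𝕜 (Fin n)} (ha : ‖a‖ = 1) {K : ℝ} (hK : 0 ≤ K) {F : Fin n → ENNReal}
    (hF : ∀ k, ‖a k‖ < 1 → ENNReal.ofReal (K * ((n - 1 : ℕ) : ℝ)) *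
      (ENNReal.ofReal (1 - ‖a k‖ ^ 2) * sectionVolume a (cube 𝕜 n α ∩ maxCone 𝕜 k)) ≤ F k) :
    ENNReal.ofReal (K * ((n : ℝ) - 2)) ≤ ∑ k, F k := by
  have h := mul_le_mul_of_nonneg_left (le_sum_mul_sectionVolume_cone hα0 hα ha hn) hK
  have hsq : ∀ k, 0 ≤ 1 - ‖a k‖ ^ 2 := fun k ↦ by
    have := norm_apply_le_one ha k
    nlinarith [norm_nonneg (a k)]
  refine (ENNReal.ofReal_le_ofReal h).trans ?_
  rw [Finset.mul_sum, ENNReal.ofReal_sum_of_nonneg fun k _ ↦ by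
    have := hsq k
    positivity]
  refine Finset.sum_le_sum fun k _ ↦ ?_
  rcases (norm_apply_le_one ha k).lt_or_eq with hk | hk
  · refine le_trans (le_of_eq ?_) (hF k hk)
    have hV : sectionVolume a (cube 𝕜 n α ∩ maxCone 𝕜 k) ≠ ⊤ :=
      ne_top_of_le_ne_top (sectionVolume_box_ne_top a fun _ ↦ α)
        (sectionVolume_mono a Set.inter_subset_left)
    conv_rhs => rw [← ENNReal.ofReal_toReal hV]
    have := hsq k
    rw [← ENNReal.ofReal_mul this, ← ENNReal.ofReal_mul (by positivity)]
    congr 1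
    ring
  · simp [hk]

theorem sum_measure_le_of_disjoint {Ω ι : Type*} [Fintype ι] [MeasurableSpace Ω] (μ : Measure Ω)
    {T : ι → Set Ω} {S : Set Ω} (hd : Pairwise (Function.onFun Disjoint T))
    (hm : ∀ i, MeasurableSet (T i)) (hS : ∀ i, T i ⊆ S) : ∑ i, μ (T i) ≤ μ S := by
  rw [← measure_biUnion_finset (fun i _ j _ h ↦ hd h) fun i _ ↦ hm i]
  exact measure_mono (Set.iUnion₂_subset fun i _ ↦ hS i)

theorem le_realPerimeter {n : ℕ} (hn : 2 ≤ n) {a : EuclideanSpace ℝ (Fin n)} (ha : ‖a‖ = 1) :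
    ENNReal.ofReal (2 * ((n : ℝ) - 2)) ≤ realPerimeter a := by
  have hα0 : (0 : ℝ) < 1 / 2 := by norm_num
  have hα : volume (Metric.closedBall (0 : ℝ) (1 / 2)) = 1 := by
    rw [Real.volume_closedBall]; norm_num
  have hn1 : ((n - 1 : ℕ) : ℝ) = ((n - 2 : ℕ) : ℝ) + 1 := by
    rw [← Nat.cast_add_one]; congr 1; omega
  have hnorm1 : ‖(1 / 2 : ℝ)‖ = 1 / 2 := by norm_num
  have hnorm2 : ‖(-(1 / 2) : ℝ)‖ = 1 / 2 := by norm_num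
  let T : Fin n → Set (EuclideanSpace ℝ (Fin n)) := fun k ↦
    faceSlice (1 / 2) a k (1 / 2 : ℝ) ∪ faceSlice (1 / 2) a k (-(1 / 2) : ℝ)
  have hT : ∀ k, Measure.euclideanHausdorffMeasure (n - 2) (T k) =
      faceVolume (1 / 2) a k (1 / 2 : ℝ) + faceVolume (1 / 2) a k (-(1 / 2) : ℝ) := fun k ↦ by
    rw [measure_union (disjoint_faceSlice (.inr (by norm_num))) (measurableSet_faceSlice _ _ _ _),
      faceVolume, faceVolume, finrank_self, one_mul]
  refine (ofReal_le_sum_faces (F := fun k ↦ Measure.euclideanHausdorffMeasure (n - 2) (T k)) hn hα0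
    hα ha zero_le_two fun k hk ↦ ?_).trans
    (sum_measure_le_of_disjoint _ (fun k l hkl ↦ ?_) (fun k ↦ ?_) fun k ↦ ?_)
  · obtain ⟨-, h⟩ := measurable_faceVolume_and_lintegral_eq (α := 1 / 2) ha hk
    -- Over the reals the exact factor is the square root, and replacing it by its square is a loss;
    -- the complex case has equality here.
    have hpow : 1 - ‖a k‖ ^ 2 ≤ √(1 - ‖a k‖ ^ 2) ^ finrank ℝ ℝ := by
      have h0 : 0 ≤ 1 - ‖a k‖ ^ 2 := by nlinarith [norm_nonneg (a k)]
      rw [finrank_self, pow_one]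
      refine Real.le_sqrt_of_sq_le ?_
      nlinarith [sq_nonneg ‖a k‖]
    have hhom : ∀ u : ℝ, ‖u‖ = 1 / 2 → ∀ t : ℝ, 0 < t → t ≤ 1 / 2 →
        faceVolume (1 / 2) a k ((t / (1 / 2)) * u) =
          ENNReal.ofReal ((t / (1 / 2)) ^ (n - 2)) * faceVolume (1 / 2) a k u := by
      intro u hu t ht ht1
      have h := faceVolume_smul a k hu (r := t / (1 / 2)) (by positivity) (by linarith)
      rwa [finrank_self, one_mul, smul_eq_mul] at h
    rw [lintegral_real_eq_Ioi_add,
      setLIntegral_Ioi_of_homogeneous hα0 (n - 2) _ (fun t ht ht1 ↦ ?_) (fun t ht ↦ ?_),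
      setLIntegral_Ioi_of_homogeneous hα0 (n - 2) (fun t ↦ faceVolume (1 / 2) a k (-t))
        (fun t ht ht1 ↦ ?_) (fun t ht ↦ ?_), ← mul_add] at h
    · rw [hT]
      calc _ ≤ ENNReal.ofReal (2 * ((n - 1 : ℕ) : ℝ)) *
            (ENNReal.ofReal (√(1 - ‖a k‖ ^ 2) ^ finrank ℝ ℝ) *
              sectionVolume a (cube ℝ n (1 / 2) ∩ maxCone ℝ k)) := by
            gcongr
        _ = _ := by
          rw [h, ← mul_assoc, ← ENNReal.ofReal_mul (by positivity), hn1]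
          -- The factor `K (n - 1)` with `K = 2` cancels the cone constant `(1/2) / (n - 1)`
          -- exactly.
          have : 2 * (((n - 2 : ℕ) : ℝ) + 1) * (1 / 2 / (((n - 2 : ℕ) : ℝ) + 1)) = 1 := by
            field_simp
          rw [this, ENNReal.ofReal_one, one_mul]
    · have := hhom _ hnorm2 t ht ht1
      rwa [show t / (1 / 2) * -(1 / 2) = -t by ring] at this
    · refine faceVolume_eq_zero a k ?_
      rwa [norm_neg, Real.norm_of_nonneg (by linarith)]
    · have := hhom _ hnorm1 t ht ht1
      rwa [show t / (1 / 2) * (1 / 2) = t by ring] at this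
    · refine faceVolume_eq_zero a k ?_
      rwa [Real.norm_of_nonneg (by linarith)]
  · exact Disjoint.union_left
      ((disjoint_faceSlice (.inl hkl)).union_right (disjoint_faceSlice (.inl hkl)))
      ((disjoint_faceSlice (.inl hkl)).union_right (disjoint_faceSlice (.inl hkl)))
  · exact (measurableSet_faceSlice _ _ _ _).union (measurableSet_faceSlice _ _ _ _)
  · exact Set.union_subset (faceSlice_subset hα0 hnorm1) (faceSlice_subset hα0 hnorm2)

theorem le_complexPerimeter {n : ℕ} (hn : 2 ≤ n) {a : EuclideanSpace ℂ (Fin n)} (ha : ‖a‖ = 1) :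
    ENNReal.ofReal (2 * Real.pi * ((n : ℝ) - 2)) ≤ complexPerimeter a := by
  set α : ℝ := 1 / √Real.pi with hαdef
  have hα0 : 0 < α := by positivity
  have hα2 : α ^ 2 = 1 / Real.pi := by
    rw [hαdef, div_pow, one_pow, Real.sq_sqrt Real.pi_pos.le]
  have hα : volume (Metric.closedBall (0 : ℂ) α) = 1 := by
    rw [Complex.volume_closedBall, ← ENNReal.ofReal_pow hα0.le, hα2,
      ← ENNReal.ofReal_coe_nnreal, ← ENNReal.ofReal_mul (by positivity), NNReal.coe_real_pi,
      one_div_mul_cancel Real.pi_ne_zero, ENNReal.ofReal_one]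
  have hn1 : ((n - 1 : ℕ) : ℝ) = ((n - 2 : ℕ) : ℝ) + 1 := by
    rw [← Nat.cast_add_one]; congr 1; omega
  let g : Fin n → ℝ → ENNReal := fun k θ ↦
    faceVolume α a k ((α : ℂ) * Complex.exp (θ * Complex.I))
  have hnorm : ∀ θ : ℝ, ‖(α : ℂ) * Complex.exp (θ * Complex.I)‖ = α := fun θ ↦ by
    rw [norm_mul, Complex.norm_exp_ofReal_mul_I, mul_one, Complex.norm_real,
      Real.norm_of_nonneg hα0.le]
  have hslice : ∀ θ, ∑ k, g k θ ≤
      Measure.euclideanHausdorffMeasure (2 * (n - 2)) (complexSlice a θ) := fun θ ↦ by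
    simp only [g, faceVolume, Complex.finrank_real_complex]
    refine sum_measure_le_of_disjoint _ (fun k l hkl ↦ disjoint_faceSlice (.inl hkl))
      (fun k ↦ measurableSet_faceSlice _ _ _ _) fun k x hx ↦ ?_
    refine ⟨faceSlice_subset hα0 (hnorm θ) hx, k, hx.2.2, fun j hj ↦ ?_⟩
    have h := hx.2.1.2.2 j hj
    rwa [hx.2.2, hnorm] at h
  -- Exchanging sum and integral needs measurability, which is established only for `‖a k‖ < 1`; the
  -- other faces are dropped.
  let f : Fin n → ℝ → ENNReal := fun k ↦ if ‖a k‖ < 1 then g k else 0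
  have hfm : ∀ k, Measurable (f k) := fun k ↦ by
    by_cases hk : ‖a k‖ < 1
    · simp only [f, if_pos hk]
      exact (measurable_faceVolume_and_lintegral_eq ha hk).1.comp (by fun_prop)
    · simp only [f, if_neg hk]
      exact measurable_zero
  have hfg : ∀ k, f k ≤ g k := fun k ↦ by
    by_cases hk : ‖a k‖ < 1
    · simp [f, hk]
    · simp [f, hk]
  refine (ofReal_le_sum_faces (F := fun k ↦ ∫⁻ θ in Set.Ico 0 (2 * Real.pi), f k θ) hn hα0 hα ha
    Real.two_pi_pos.le fun k hk ↦ ?_).trans ?_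
  · obtain ⟨hm, h⟩ := measurable_faceVolume_and_lintegral_eq (α := α) ha hk
    have hpow : √(1 - ‖a k‖ ^ 2) ^ finrank ℝ ℂ = 1 - ‖a k‖ ^ 2 := by
      have h0 : 0 ≤ 1 - ‖a k‖ ^ 2 := by nlinarith [norm_nonneg (a k)]
      rw [Complex.finrank_real_complex, Real.sq_sqrt h0]
    have hper : Function.Periodic (g k) (2 * Real.pi) := fun θ ↦ by
      simp only [g]
      congr 2
      push_cast
      rw [add_mul, Complex.exp_periodic]
    rw [hpow, lintegral_complex_of_homogeneous hα0 (2 * (n - 2)) hm (fun r t ht hr hr1 ↦ ?_)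
      (fun t ht ↦ faceVolume_eq_zero a k ht)] at h
    · simp only [f, if_pos hk]
      rw [h, setLIntegral_periodic_eq hper, ← mul_assoc, ← ENNReal.ofReal_mul (by positivity), hα2,
        hn1]
      -- With `α² = 1/π` and `N + 2 = 2(n - 1)`, the radial constant is the inverse of `2π(n - 1)`.
      have : 2 * Real.pi * (((n - 2 : ℕ) : ℝ) + 1) *
          (1 / Real.pi / (((2 * (n - 2) : ℕ) : ℝ) + 2)) = 1 := by
        push_cast
        field_simp
      rw [this, ENNReal.ofReal_one, one_mul]
    · have h := faceVolume_smul a k ht hr hr1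
      rwa [Complex.finrank_real_complex] at h
  · rw [← lintegral_finsetSum _ fun k _ ↦ hfm k]
    exact lintegral_mono fun θ ↦
      (Finset.sum_le_sum fun k _ ↦ hfg k θ).trans (hslice θ)

theorem proposition11 (n : ℕ) (hn : 2 ≤ n) :
    (∀ a : EuclideanSpace ℝ (Fin n), ‖a‖ = 1 →
      ENNReal.ofReal (2 * ((n : ℝ) - 2)) ≤ realPerimeter a) ∧
    (∀ a : EuclideanSpace ℂ (Fin n), ‖a‖ = 1 →
      ENNReal.ofReal (2 * Real.pi * ((n : ℝ) - 2)) ≤ complexPerimeter a) :=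
  ⟨fun _ ha ↦ le_realPerimeter hn ha, fun _ ha ↦ le_complexPerimeter hn ha⟩

end Assembly
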